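/- \textbf{Model.} A $(k+m)$-tape \emph{oracle quantum Turing machine with $m$ query tapes} over a finite alphabet $\Sigma\ni\#,0,1$ ($\#$ is the blank symbol) has a finite state set $Q$, an initial state $q_0$, final states $Q_f\subseteq Q$, distinct pre-query states $q_p^1,\dots,q_p^m\notin Q_f$ and post-query states $q_a^1,\dots,q_a^m$ (distinct from each other and from the $q_p^i$), and a transition function $\delta:(Q\setminus\{q_p^1,\dots,q_p^m\})\times\Sigma^{k+m}\to\mathbb{C}^{Q\times\Sigma^{k+m}\times\{L,N,R\}^{k+m}}$. Its tapes are two-way infinite, and configurations have finitely many nonblank cells. Relative to oracles $A_1,\dots,A_m\subseteq\Sigma^*$, a configuration in a state other than the $q_p^i$ evolves by $\delta$; a configuration in state $q_p^i$ executes a \emph{query} in one step: it goes to state $q_a^i$, and if the nonblank part of the $i$th query tape is a single block of the form $y\circ b$ ($y$ a word, $b$ a bit), then $b$ is replaced by $b\oplus A_i(y)$, where $A_i(y)=1$ if $y\in A_i$ and $A_i(y)=0$ otherwise; nothing else changes. The machine is \emph{well-formed} if its time-evolution operator (on finite superpositions of configurations) preserves the $L_2$-norm relative to all oracles. It is in \emph{normal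 form} if for every $q_f\in Q_f$ there is $d\in\{L,N,R\}^{k+m}$ with $\delta(q_f,\sigma)=|q_0\rangle|\sigma\rangle|d\rangle$ for all $\sigma$. On input $x=(x_1,\dots,x_k)$, it starts in state $q_0$ with $x_i$ on tape $i$ from the start cell on, the query tapes empty, and all heads in the start cells. It \emph{halts in time $T$} on $x$ if $T$ is the least time at which the superposition consists of final configurations only. Given a designated output tape, the \emph{acceptance probability} on $x$ is the probability of observing the symbol $1$ in the start cell of the output tape at the halting time. A \emph{computation path} is a sequence of configurations that starts in the initial configuration and in which each step has nonzero amplitude. \textbf{Statement.} Let $M$ be a $(k+1)$-tape, well-formed oracle quantum Turing machine in normal form with a single query tape, over the alphabet $\Sigma$. There exist a finite alphabet $\Sigma'\supseteq\Sigma$ (with the same $\#,0,1$) and a $(k+2)$-tape, well-formed oracle quantum Turing machine $M'$ with two query tapes over $\Sigma'$ such that, for every oracle $A\subseteq\Sigma^*$, every input $x\in(\Sigma^*)^k$ and every $T=T(x)\in\mathbb{N}$ for which $M$ with oracle $A$ halts in time $T(x)$ on $x$: \begin{enumerate} \item $M'$ with oracles $(A,A)$ halts in time $7T(x)$ on input $x$;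 \item $M'$ with oracles $(A,A)$ makes exactly $T(x)$ queries (to the two oracles together) along each computation path of length $7T(x)$ on input $x$; \item $\mu_{M'}^{(A,A)}(x)=\mu_M^{A}(x)$, where $\mu$ is the acceptance probability and $M'$ has the same output tape as $M$, which may be any of the tapes $1,\dots,k+1$. \end{enumerate} -/

import Mathlib

universe u

/-- A finite tape alphabet with a distinguished blank symbol and the two binary bits. -/
structure Alphabet where
  Sym : Type u
  fintypeSym : Fintype Sym
  blank : Sym
  zero : Sym
  one : Sym
  zero_ne_blank : zero ≠ blank
  one_ne_blank : one ≠ blank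
  zero_ne_one : zero ≠ one

attribute [instance] Alphabet.fintypeSym

namespace Alphabet

/-- The tape symbol of a bit. -/
def bit (Γ : Alphabet.{u}) (b : Bool) : Γ.Sym := if b then Γ.one else Γ.zero

/-- Inclusion of an alphabet into a larger one, respecting the blank and the bits. -/
structure Inclusion (Γ Γ' : Alphabet.{u}) where
  toFun : Γ.Sym → Γ'.Sym
  injective : Function.Injective toFun
  map_blank : toFun Γ.blank = Γ'.blank
  map_zero : toFun Γ.zero = Γ'.zero
  map_one : toFun Γ.one = Γ'.one

/-- A word over the small alphabet, read as a word over the large one. -/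
def Inclusion.word {Γ Γ' : Alphabet.{u}} (ι : Γ.Inclusion Γ') (w : List Γ.Sym) : List Γ'.Sym :=
  w.map ι.toFun

/-- An oracle over the small alphabet, read as a set of words over the large one. -/
def Inclusion.oracle {Γ Γ' : Alphabet.{u}} (ι : Γ.Inclusion Γ') (A : Set (List Γ.Sym)) :
    Set (List Γ'.Sym) :=
  ι.word '' A

end Alphabet

/-- Contents of a two-way infinite tape with cells indexed by `ℤ`; all but finitely many cells
are blank. -/
def Tape (Γ : Alphabet.{u}) : Type u :=
  {t : ℤ → Γ.Sym // {i : ℤ | t i ≠ Γ.blank}.Finite}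

namespace Tape

variable {Γ : Alphabet.{u}}

/-- Overwrite the symbol in cell `i` by `a`. -/
noncomputable def write (t : Tape Γ) (i : ℤ) (a : Γ.Sym) : Tape Γ :=
  ⟨Function.update t.1 i a, by
    refine (t.2.union (Set.finite_singleton i)).subset ?_
    intro j hj
    by_cases h : j = i
    · right; exact h
    · left; simpa [Function.update_of_ne h] using hj⟩

/-- The tape which holds the word `w` in the cells `s, s + 1, …` and is blank elsewhere. -/
noncomputable def ofWord (s : ℤ) (w : List Γ.Sym) : Tape Γ :=
  ⟨fun i => if s ≤ i then w.getD (i - s).toNat Γ.blank else Γ.blank, by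
    refine (Set.finite_Ico s (s + w.length)).subset ?_
    intro i hi
    simp only [Set.mem_ofPred_eq] at hi
    by_cases h : s ≤ i
    · simp only [h, if_true] at hi
      refine ⟨h, ?_⟩
      by_contra hlt
      exact hi (List.getD_eq_default _ _ (by omega))
    · simp [h] at hi⟩

/-- The only nonblank cells of the tape form one block that holds a word `y ∘ b`, where `y` is
a word of nonblank symbols and the target bit `b` is in cell `i`. -/
def HoldsQuery (t : Tape Γ) (y : List Γ.Sym) (b : Bool) (i : ℤ) : Prop :=
  (∀ a ∈ y, a ≠ Γ.blank) ∧ t = ofWord (i - y.length) (y ++ [Γ.bit b])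

open Classical in
/-- The effect of a query to the oracle `A` on the query tape: `y ∘ b` becomes
`y ∘ (b ⊕ A(y))`. A tape that does not hold a word of the form `y ∘ b` is left as it is. -/
noncomputable def query (A : Set (List Γ.Sym)) (t : Tape Γ) : Tape Γ :=
  ⟨fun i =>
    if ∃ y b, t.HoldsQuery y b i ∧ y ∈ A then Equiv.swap Γ.zero Γ.one (t.1 i) else t.1 i, by
    refine t.2.subset ?_
    intro i hi hb
    apply hi
    simp only [hb]
    rw [Equiv.swap_apply_of_ne_of_ne Γ.zero_ne_blank.symm Γ.one_ne_blank.symm, ite_self]⟩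

end Tape

/-- Head moves: one cell to the left, no movement, one cell to the right. -/
inductive Dir : Type
  | L
  | N
  | R
  deriving DecidableEq

instance : Fintype Dir where
  elems := {.L, .N, .R}
  complete := by intro d; cases d <;> simp

/-- The displacement of a head. -/
def Dir.shift : Dir → ℤ
  | .L => -1
  | .N => 0
  | .R => 1

/-- A `(k+m)`-tape oracle quantum Turing machine with `m` query tapes, all tapes having the
alphabet `Γ`. Tapes `0, …, k-1` are ordinary tapes and tape `k+i` is the `i`-th query tape;
`pre i` and `post i` are the pre-query and post-query states of the `i`-th query tape.
`δ p σ (q, τ, d)` is the amplitude of the transition from state `p` scanning `σ` to state `q`,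
writing `τ` and moving the heads by `d`. The transition function is a function on the states
that are not pre-query states; its values at pre-query states have no meaning and are not used. -/
structure OracleQTM (Γ : Alphabet.{u}) (k m : ℕ) where
  State : Type u
  fintypeState : Fintype State
  init : State
  final : Set State
  pre : Fin m → State
  post : Fin m → State
  pre_injective : Function.Injective pre
  post_injective : Function.Injective post
  pre_ne_post : ∀ i j, pre i ≠ post j
  pre_notMem_final : ∀ i, pre i ∉ final
  δ : State → (Fin (k + m) → Γ.Sym) →
    State × (Fin (k + m) → Γ.Sym) × (Fin (k + m) → Dir) → ℂ

attribute [instance] OracleQTM.fintypeState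

namespace OracleQTM

variable {Γ : Alphabet.{u}} {k m : ℕ}

/-- A configuration: internal state, head positions and tape contents. -/
structure Config (M : OracleQTM Γ k m) where
  state : M.State
  head : Fin (k + m) → ℤ
  tape : Fin (k + m) → Tape Γ

variable (M : OracleQTM Γ k m)

/-- The initial configuration on input `x`: all heads are in the start cells `0`, the word `x i`
is in tape `i` from the start cell on, and the query tapes are empty. -/
noncomputable def initConfig (x : Fin k → List Γ.Sym) : M.Config where
  state := M.init
  head := fun _ => 0
  tape := Fin.addCases (fun i => Tape.ofWord 0 (x i)) (fun _ => Tape.ofWord 0 [])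

/-- The symbols scanned by the heads. -/
def Config.scan {M : OracleQTM Γ k m} (c : M.Config) (i : Fin (k + m)) : Γ.Sym :=
  (c.tape i).1 (c.head i)

/-- The configuration after entering state `q`, writing `τ` and moving the heads by `d`. -/
noncomputable def Config.move {M : OracleQTM Γ k m} (c : M.Config)
    (o : M.State × (Fin (k + m) → Γ.Sym) × (Fin (k + m) → Dir)) : M.Config where
  state := o.1
  head := fun i => c.head i + (o.2.2 i).shift
  tape := fun i => (c.tape i).write (c.head i) (o.2.1 i)

/-- The configuration after a query to `A` with the `i`-th query tape: control passes to the
`i`-th post-query state, and nothing but the `i`-th query tape changes. -/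
noncomputable def Config.query {M : OracleQTM Γ k m} (c : M.Config) (i : Fin m)
    (A : Set (List Γ.Sym)) : M.Config where
  state := M.post i
  head := c.head
  tape := Function.update c.tape (Fin.natAdd k i) ((c.tape (Fin.natAdd k i)).query A)

/-- A configuration in which an oracle query is executed in the next step. -/
def Config.IsQuery {M : OracleQTM Γ k m} (c : M.Config) : Prop :=
  ∃ i, c.state = M.pre i

open Classical in
/-- One step from a configuration, relative to the oracles `𝒜`: a superposition of
configurations. -/
noncomputable def step (𝒜 : Fin m → Set (List Γ.Sym)) (c : M.Config) : M.Config →₀ ℂ :=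
  if h : c.IsQuery then Finsupp.single (c.query h.choose (𝒜 h.choose)) 1
  else ∑ o, Finsupp.single (c.move o) (M.δ c.state c.scan o)

/-- The time-evolution operator, on the space of finite superpositions. -/
noncomputable def evolution (𝒜 : Fin m → Set (List Γ.Sym)) :
    (M.Config →₀ ℂ) →ₗ[ℂ] (M.Config →₀ ℂ) :=
  Finsupp.linearCombination ℂ (M.step 𝒜)

/-- The superposition after `t` steps on input `x`. -/
noncomputable def superposition (𝒜 : Fin m → Set (List Γ.Sym)) (x : Fin k → List Γ.Sym)
    (t : ℕ) : M.Config →₀ ℂ :=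
  ((M.evolution 𝒜) ^ t) (Finsupp.single (M.initConfig x) 1)

/-- The machine is well-formed: relative to any oracles, the time-evolution operator preserves
the `L₂`-norm. -/
def WellFormed : Prop :=
  ∀ (𝒜 : Fin m → Set (List Γ.Sym)) (φ : M.Config →₀ ℂ),
    ((M.evolution 𝒜 φ).sum fun _ a => ‖a‖ ^ 2) = φ.sum fun _ a => ‖a‖ ^ 2

open Classical in
/-- The machine is in normal form: for every final state `q` there is a direction `d` such that
`δ(q, σ) = |q₀⟩|σ⟩|d⟩` for all `σ`. -/
def NormalForm : Prop :=
  ∀ q ∈ M.final, ∃ d : Fin (k + m) → Dir, ∀ σ : Fin (k + m) → Γ.Sym,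
    M.δ q σ = Pi.single (M.init, σ, d) 1

/-- On input `x` and relative to `𝒜`, the machine halts in time `T`: the number `T` is minimal
such that the superposition at time `T` consists of final configurations only. -/
def HaltsIn (𝒜 : Fin m → Set (List Γ.Sym)) (x : Fin k → List Γ.Sym) (T : ℕ) : Prop :=
  IsLeast {t : ℕ | ∀ c : M.Config, M.superposition 𝒜 x t c ≠ 0 → c.state ∈ M.final} T

open Classical in
/-- The probability that the symbol `1` is observed in the start cell of tape `j` at time `T`.
When the machine halts in time `T` and `j` is its output tape, this is the acceptance
probability. -/
noncomputable def acceptProb (𝒜 : Fin m → Set (List Γ.Sym)) (x : Fin k → List Γ.Sym) (T : ℕ)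
    (j : Fin (k + m)) : ℝ :=
  (M.superposition 𝒜 x T).sum fun c a => if (c.tape j).1 0 = Γ.one then ‖a‖ ^ 2 else 0

/-- `c 0, …, c n` is a computation path on input `x`: it starts in the initial configuration and
each of its `n` steps has nonzero amplitude. -/
def IsPath (𝒜 : Fin m → Set (List Γ.Sym)) (x : Fin k → List Γ.Sym) (n : ℕ)
    (c : ℕ → M.Config) : Prop :=
  c 0 = M.initConfig x ∧ ∀ t < n, M.step 𝒜 (c t) (c (t + 1)) ≠ 0

open Classical in
/-- The number of queries, to any of the oracles, that are executed in the first `n` steps of a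
path. -/
noncomputable def queryCount (n : ℕ) (c : ℕ → M.Config) : ℕ :=
  ((Finset.range n).filter fun t => (c t).IsQuery).card

end OracleQTM

/-! The machine `uniformQuery` replaces each step of `M` by a block of seven steps, counted by a
cyclic phase in its state. Phase 0 performs the step of `M`, which may be a query on the first query
tape. If that step was no query, phase 1 parks the state of `M` in a register attached to the cell
scanned on the second query tape. The control is then `none`, the same for all states of `M`, so a
single pre-query state serves for a dummy query in phase 2. Phase 3 retrieves the parked state, and
phases 4 to 6 only advance the phase. The dummy query has no effect, because a symbol carrying a
parked state is never a bit.

The machine has to know whether a query has just been made. This can be read off the new state: by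
`WellFormed.step_apply_eq_zero`, the transition function of a well-formed machine never leads to the
post-query state. Indeed, relative to the empty oracle every post-query configuration is already the
image of a pre-query configuration, and images of distinct configurations are orthogonal. Hence the
exchange of registers is skipped exactly in the post-query state, and each block contains exactly
one query.

Well-formedness means that one-step images of basis configurations are orthonormal. Deterministic
steps are injective because the exchange is an involution. Simulated steps are copies of steps of
`M` that leave the data invisible to `M` untouched. Steps of different kinds within one phase are
separated by the resulting control register.

On encoded configurations, seven steps act as one step of `M` with the same amplitudes
(`step_embed_zero`, `step_embed_of_ne_zero`). The statements on halting and acceptance follow from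
`superposition_seven_mul`, and the query count from `path_block`. -/

/-! ### Inner products of finite superpositions and norm-preserving maps. -/

namespace Finsupp

variable {α β : Type*}

/-- The standard inner product of finitely supported complex functions. -/
noncomputable def cinner (φ ψ : α →₀ ℂ) : ℂ := φ.sum fun c a => star a * ψ c

@[simp] theorem cinner_zero_left (ψ : α →₀ ℂ) : cinner 0 ψ = 0 := Finsupp.sum_zero_index

@[simp] theorem cinner_zero_right (φ : α →₀ ℂ) : cinner φ 0 = 0 := by
  simp [cinner, Finsupp.sum]

theorem cinner_add_left (φ₁ φ₂ ψ : α →₀ ℂ) :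
    cinner (φ₁ + φ₂) ψ = cinner φ₁ ψ + cinner φ₂ ψ := by
  classical
  exact Finsupp.sum_add_index' (by simp) (by simp [add_mul])

theorem cinner_add_right (φ ψ₁ ψ₂ : α →₀ ℂ) :
    cinner φ (ψ₁ + ψ₂) = cinner φ ψ₁ + cinner φ ψ₂ := by
  simp [cinner, Finsupp.sum, mul_add, Finset.sum_add_distrib]

theorem cinner_smul_left (z : ℂ) (φ ψ : α →₀ ℂ) : cinner (z • φ) ψ = star z * cinner φ ψ := by
  unfold cinner
  rw [Finsupp.sum_smul_index (by simp), Finsupp.mul_sum]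
  simp [mul_assoc]

theorem cinner_smul_right (z : ℂ) (φ ψ : α →₀ ℂ) : cinner φ (z • ψ) = z * cinner φ ψ := by
  simp [cinner, Finsupp.sum, Finset.mul_sum, mul_left_comm]

@[simp] theorem cinner_single_left (c : α) (a : ℂ) (ψ : α →₀ ℂ) :
    cinner (single c a) ψ = star a * ψ c :=
  Finsupp.sum_single_index (by simp)

theorem star_cinner (φ ψ : α →₀ ℂ) : star (cinner φ ψ) = cinner ψ φ := by
  induction φ using Finsupp.induction_linear with
  | zero => simp
  | add f g hf hg => simp only [cinner_add_left, cinner_add_right, star_add, hf, hg]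
  | single c a =>
    classical
    simp only [cinner, Finsupp.sum_single_index, star_zero, zero_mul, star_mul, star_star]
    rw [Finsupp.sum_eq_single c]
    · simp
    · intro d _ hd
      simp [hd.symm]
    · simp

theorem cinner_self (φ : α →₀ ℂ) : cinner φ φ = ((φ.sum fun _ a => ‖a‖ ^ 2 : ℝ) : ℂ) := by
  simp only [cinner, Finsupp.sum, Complex.ofReal_sum]
  refine Finset.sum_congr rfl fun c _ => ?_
  rw [Complex.ofReal_pow]
  exact Complex.conj_mul' _

theorem cinner_mapDomain {f : α → β} (hf : Function.Injective f) (φ ψ : α →₀ ℂ) :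
    cinner (mapDomain f φ) (mapDomain f ψ) = cinner φ ψ := by
  unfold cinner
  rw [Finsupp.sum_mapDomain_index (by simp) (by simp [add_mul])]
  simp [Finsupp.mapDomain_apply hf]

theorem cinner_eq_zero_of_disjoint {φ ψ : α →₀ ℂ} (h : ∀ c, φ c ≠ 0 → ψ c = 0) :
    cinner φ ψ = 0 :=
  Finset.sum_eq_zero fun c hc => by simp [h c (Finsupp.mem_support_iff.1 hc)]

/-- A linear map which preserves the norm preserves the inner product. -/
theorem cinner_map_map {U : (α →₀ ℂ) →ₗ[ℂ] (β →₀ ℂ)}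
    (hU : ∀ φ, ((U φ).sum fun _ a => ‖a‖ ^ 2) = φ.sum fun _ a => ‖a‖ ^ 2) (φ ψ : α →₀ ℂ) :
    cinner (U φ) (U ψ) = cinner φ ψ := by
  have h : ∀ χ, cinner (U χ) (U χ) = cinner χ χ := fun χ => by
    rw [cinner_self, cinner_self, hU]
  -- Polarization: `φ + ψ` yields the real part of the inner product, `φ + i ψ` the imaginary part.
  have h1 := h (φ + ψ)
  have h2 := h (φ + Complex.I • ψ)
  simp only [map_add, map_smul, cinner_add_left, cinner_add_right, cinner_smul_left,
    cinner_smul_right, h] at h1 h2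
  have hI : star Complex.I = -Complex.I := Complex.conj_I
  rw [hI] at h2
  have h3 : cinner (U φ) (U ψ) + cinner (U ψ) (U φ) = cinner φ ψ + cinner ψ φ := by
    linear_combination h1
  have h4 : Complex.I * (cinner (U φ) (U ψ) - cinner (U ψ) (U φ)) =
      Complex.I * (cinner φ ψ - cinner ψ φ) := by
    linear_combination h2
  have h5 := mul_left_cancel₀ Complex.I_ne_zero h4
  linear_combination (h3 + h5) / 2

/-- A linear map which sends the standard basis to an orthonormal family preserves the norm. -/
theorem sum_norm_sq_linearCombination {v : α → β →₀ ℂ}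
    (hv : ∀ c c', cinner (v c) (v c') = single c (1 : ℂ) c') (φ : α →₀ ℂ) :
    ((linearCombination ℂ v φ).sum fun _ a => ‖a‖ ^ 2) = φ.sum fun _ a => ‖a‖ ^ 2 := by
  have h : ∀ φ ψ : α →₀ ℂ,
      cinner (linearCombination ℂ v φ) (linearCombination ℂ v ψ) = cinner φ ψ := by
    intro φ ψ
    induction φ using Finsupp.induction_linear with
    | zero => simp
    | add f g hf hg => simp only [map_add, cinner_add_left, hf, hg]
    | single c a =>
      induction ψ using Finsupp.induction_linear with
      | zero => simp
      | add f g hf hg => simp only [map_add, cinner_add_right, hf, hg]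
      | single c' b =>
        classical
        simp only [linearCombination_single, cinner_smul_left, cinner_smul_right, hv,
          cinner_single_left, single_apply]
        split_ifs with h1 h2 h2
        · simp [mul_comm]
        · exact absurd h1.symm h2
        · exact absurd h2.symm h1
        · simp
  have := h φ φ
  rw [cinner_self, cinner_self] at this
  exact_mod_cast this

end Finsupp

/-! ### Queries on tapes: involutivity and change of alphabet. -/

namespace Tape

variable {Γ : Alphabet.{u}}

theorem ext {t t' : Tape Γ} (h : ∀ i, t.1 i = t'.1 i) : t = t' :=
  Subtype.ext (funext h)

theorem write_apply (t : Tape Γ) (i : ℤ) (a : Γ.Sym) (j : ℤ) :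
    (t.write i a).1 j = if j = i then a else t.1 j := by
  simp [write, Function.update_apply]

theorem write_apply_self (t : Tape Γ) (i : ℤ) (a : Γ.Sym) :
    (t.write i a).1 i = a := by
  rw [write_apply, if_pos rfl]

theorem write_apply_of_ne (t : Tape Γ) {i j : ℤ} (a : Γ.Sym)
    (h : j ≠ i) : (t.write i a).1 j = t.1 j := by
  rw [write_apply, if_neg h]

theorem write_write (t : Tape Γ) (i : ℤ) (a b : Γ.Sym) :
    (t.write i a).write i b = t.write i b := by
  refine ext fun j => ?_
  simp only [write_apply]
  split_ifs <;> rfl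

@[simp] theorem write_self (t : Tape Γ) (i : ℤ) : t.write i (t.1 i) = t :=
  ext fun j => by rw [write_apply]; split_ifs with h <;> simp [h]

open Classical in
theorem query_apply_of (A : Set (List Γ.Sym)) {t : Tape Γ} {i : ℤ}
    (h : ∃ y b, t.HoldsQuery y b i ∧ y ∈ A) :
    (t.query A).1 i = Equiv.swap Γ.zero Γ.one (t.1 i) := by
  exact if_pos h

theorem query_apply_of_not (A : Set (List Γ.Sym)) {t : Tape Γ} {i : ℤ}
    (h : ¬ ∃ y b, t.HoldsQuery y b i ∧ y ∈ A) : (t.query A).1 i = t.1 i := by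
  classical
  exact if_neg h

/-- A query does not change a tape on which no bit is written. -/
theorem query_eq_self (A : Set (List Γ.Sym)) {t : Tape Γ}
    (h0 : ∀ i, t.1 i ≠ Γ.zero) (h1 : ∀ i, t.1 i ≠ Γ.one) : t.query A = t := by
  refine ext fun i => ?_
  classical
  by_cases h : ∃ y b, t.HoldsQuery y b i ∧ y ∈ A
  · rw [query_apply_of A h, Equiv.swap_apply_of_ne_of_ne (h0 i) (h1 i)]
  · exact query_apply_of_not A h

theorem query_empty (t : Tape Γ) : t.query ∅ = t :=
  ext fun _ => query_apply_of_not ∅ (by simp)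

theorem ofWord_apply (s : ℤ) (w : List Γ.Sym) (i : ℤ) :
    (ofWord s w).1 i = if s ≤ i then w.getD (i - s).toNat Γ.blank else Γ.blank := rfl

theorem _root_.Alphabet.bit_ne_blank (Γ : Alphabet.{u}) (b : Bool) : Γ.bit b ≠ Γ.blank := by
  cases b
  · exact Γ.zero_ne_blank
  · exact Γ.one_ne_blank

open Classical in
theorem _root_.Alphabet.swap_bit (Γ : Alphabet.{u}) (b : Bool) :
    Equiv.swap Γ.zero Γ.one (Γ.bit b) = Γ.bit (!b) := by
  cases b <;> simp [Alphabet.bit]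

/-- Coordinates are taken relative to the target cell `i`, so that blocks differing only in the
target bit can be compared cell by cell. -/
theorem ofWord_block_apply (i : ℤ) (y : List Γ.Sym) (a : Γ.Sym) (j : ℤ) :
    (ofWord (i - y.length) (y ++ [a])).1 j =
      if j = i then a else if i - y.length ≤ j ∧ j < i then
        y.getD (j - (i - y.length)).toNat Γ.blank else Γ.blank := by
  rw [ofWord_apply]
  by_cases h1 : j = i
  · subst h1
    have : (j - (j - (y.length : ℤ))).toNat = y.length := by omega
    rw [this]
    simp
  · rw [if_neg h1]
    by_cases h2 : i - y.length ≤ j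
    · rw [if_pos h2]
      by_cases h3 : j < i
      · rw [if_pos ⟨h2, h3⟩, List.getD_append _ _ _ _ (by omega)]
      · rw [if_neg (by tauto)]
        apply List.getD_eq_default
        simp
        omega
    · rw [if_neg h2, if_neg (by tauto)]

theorem HoldsQuery.apply_target {t : Tape Γ} {y : List Γ.Sym} {b : Bool} {i : ℤ}
    (h : t.HoldsQuery y b i) : t.1 i = Γ.bit b := by
  rw [h.2, ofWord_block_apply, if_pos rfl]

theorem HoldsQuery.le_target {t : Tape Γ} {y : List Γ.Sym} {b : Bool} {i j : ℤ}
    (h : t.HoldsQuery y b i) (hj : t.1 j ≠ Γ.blank) : j ≤ i := by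
  by_contra hlt
  apply hj
  rw [h.2, ofWord_block_apply, if_neg (by omega), if_neg (by omega)]

/-- The target is the rightmost nonblank cell. Consequently a query changes at most one cell. -/
theorem HoldsQuery.target_unique {t : Tape Γ} {y y' : List Γ.Sym} {b b' : Bool} {i i' : ℤ}
    (h : t.HoldsQuery y b i) (h' : t.HoldsQuery y' b' i') : i = i' := by
  apply le_antisymm
  · exact h'.le_target (by rw [h.apply_target]; exact Γ.bit_ne_blank b)
  · exact h.le_target (by rw [h'.apply_target]; exact Γ.bit_ne_blank b')

/-- Only the target bit flips, so the tape still asks about the same word, and a second query undoes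
the first. -/
theorem HoldsQuery.query {A : Set (List Γ.Sym)} {t : Tape Γ} {y : List Γ.Sym} {b : Bool} {i : ℤ}
    (h : t.HoldsQuery y b i) (hy : y ∈ A) : (t.query A).HoldsQuery y (!b) i := by
  refine ⟨h.1, ext fun j => ?_⟩
  by_cases hj : j = i
  · subst hj
    rw [query_apply_of A ⟨y, b, h, hy⟩, h.apply_target, ofWord_block_apply, if_pos rfl]
    exact Γ.swap_bit b
  · rw [query_apply_of_not A, h.2]
    · simp only [ofWord_block_apply, if_neg hj]
    · rintro ⟨y', b', h', -⟩
      exact hj (h'.target_unique h)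

/-- Queries are involutive. -/
theorem query_query (A : Set (List Γ.Sym)) (t : Tape Γ) : (t.query A).query A = t := by
  by_cases h : ∃ i y b, t.HoldsQuery y b i ∧ y ∈ A
  · obtain ⟨i, y, b, h, hy⟩ := h
    have h2 := (h.query hy).query hy
    rw [Bool.not_not] at h2
    exact h2.2.trans h.2.symm
  · have : t.query A = t := ext fun i => query_apply_of_not A fun hi => h ⟨i, hi⟩
    rw [this, this]

theorem query_injective (A : Set (List Γ.Sym)) : Function.Injective (query (Γ := Γ) A) :=
  Function.Involutive.injective (query_query A)

variable {Γ' : Alphabet.{u}} (ι : Γ.Inclusion Γ')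

/-- A tape over the small alphabet, read as a tape over the large one. -/
def lift (t : Tape Γ) : Tape Γ' :=
  ⟨fun i => ι.toFun (t.1 i), t.2.subset fun i hi h => hi (by simp only [h, ι.map_blank])⟩

@[simp] theorem lift_apply (t : Tape Γ) (i : ℤ) : (t.lift ι).1 i = ι.toFun (t.1 i) := rfl

theorem lift_injective : Function.Injective (lift ι) := fun _ _ h =>
  ext fun i => ι.injective (congrArg (fun s : Tape Γ' => s.1 i) h)

theorem lift_ofWord (s : ℤ) (w : List Γ.Sym) : (ofWord s w).lift ι = ofWord s (ι.word w) := by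
  refine ext fun i => ?_
  rw [lift_apply, ofWord_apply, ofWord_apply, Alphabet.Inclusion.word, ← ι.map_blank,
    List.getD_map, apply_ite ι.toFun]

theorem _root_.Alphabet.Inclusion.map_bit (b : Bool) : ι.toFun (Γ.bit b) = Γ'.bit b := by
  cases b
  · exact ι.map_zero
  · exact ι.map_one

theorem holdsQuery_lift (t : Tape Γ) (y : List Γ.Sym) (b : Bool) (i : ℤ) :
    (t.lift ι).HoldsQuery (ι.word y) b i ↔ t.HoldsQuery y b i := by
  have hw : ι.word y ++ [Γ'.bit b] = ι.word (y ++ [Γ.bit b]) := by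
    simp [Alphabet.Inclusion.word, ι.map_bit]
  have hl : (ι.word y).length = y.length := List.length_map _
  unfold HoldsQuery
  rw [hw, hl, ← lift_ofWord, (lift_injective ι).eq_iff]
  refine and_congr_left fun _ => ?_
  simp only [Alphabet.Inclusion.word, List.forall_mem_map, ← ι.map_blank, ι.injective.ne_iff]

/-- Every word of the lifted oracle is the image of a word of `A`, so the larger alphabet creates no
new positive answers. The inclusion respects the two bits and hence their exchange. -/
theorem lift_query (A : Set (List Γ.Sym)) (t : Tape Γ) :
    (t.query A).lift ι = (t.lift ι).query (ι.oracle A) := by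
  classical
  refine ext fun i => ?_
  rw [lift_apply]
  have key : (∃ y b, (t.lift ι).HoldsQuery y b i ∧ y ∈ ι.oracle A) ↔
      ∃ y b, t.HoldsQuery y b i ∧ y ∈ A := by
    constructor
    · rintro ⟨_, b, h, y, hy, rfl⟩
      exact ⟨y, b, (holdsQuery_lift ι t y b i).1 h, hy⟩
    · rintro ⟨y, b, h, hy⟩
      exact ⟨ι.word y, b, (holdsQuery_lift ι t y b i).2 h, y, hy, rfl⟩
  by_cases h : ∃ y b, t.HoldsQuery y b i ∧ y ∈ A
  · rw [query_apply_of A h, query_apply_of _ (key.2 h), lift_apply]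
    obtain ⟨y, b, h, -⟩ := h
    rw [h.apply_target, ι.map_bit]
    exact (congrArg ι.toFun (Γ.swap_bit b)).trans ((ι.map_bit _).trans (Γ'.swap_bit b).symm)
  · rw [query_apply_of_not A h, query_apply_of_not _ (mt key.1 h), lift_apply]

end Tape

/-! ### Single steps and orthonormality for well-formed machines. -/

namespace OracleQTM

variable {Γ : Alphabet.{u}} {k m : ℕ} (M : OracleQTM Γ k m)

theorem Config.ext' {M : OracleQTM Γ k m} {c c' : M.Config} (h1 : c.state = c'.state)
    (h2 : ∀ i, c.head i = c'.head i) (h3 : ∀ i, c.tape i = c'.tape i) : c = c' := by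
  cases c
  cases c'
  obtain rfl := h1
  obtain rfl : _ = _ := funext h2
  obtain rfl : _ = _ := funext h3
  rfl

theorem step_of_state_eq_pre (𝒜 : Fin m → Set (List Γ.Sym)) {c : M.Config} {i : Fin m}
    (h : c.state = M.pre i) : M.step 𝒜 c = Finsupp.single (c.query i (𝒜 i)) 1 := by
  have hq : c.IsQuery := ⟨i, h⟩
  have hi : hq.choose = i := M.pre_injective (hq.choose_spec.symm.trans h)
  rw [step, dif_pos hq, hi]

theorem step_of_not_isQuery (𝒜 : Fin m → Set (List Γ.Sym)) {c : M.Config} (h : ¬ c.IsQuery) :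
    M.step 𝒜 c = ∑ o, Finsupp.single (c.move o) (M.δ c.state c.scan o) := by
  classical
  rw [step, dif_neg h]

/-- Queries are injective on the configurations in the pre-query state. -/
theorem Config.query_injective {M : OracleQTM Γ k m} {c c' : M.Config} {i : Fin m}
    {A : Set (List Γ.Sym)} (h : c.state = M.pre i) (h' : c'.state = M.pre i)
    (heq : c.query i A = c'.query i A) : c = c' := by
  refine Config.ext' (h.trans h'.symm) (fun j => congrFun (congrArg Config.head heq) j)
    fun j => ?_
  have hj := congrFun (congrArg Config.tape heq) j
  simp only [Config.query] at hj
  by_cases hji : j = Fin.natAdd k i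
  · subst hji
    simp only [Function.update_self] at hj
    exact Tape.query_injective A hj
  · simpa [Function.update_of_ne hji] using hj

variable {M}

theorem WellFormed.cinner_step (hM : M.WellFormed) (𝒜 : Fin m → Set (List Γ.Sym))
    (c c' : M.Config) :
    Finsupp.cinner (M.step 𝒜 c) (M.step 𝒜 c') = Finsupp.single c (1 : ℂ) c' := by
  classical
  have := Finsupp.cinner_map_map (hM 𝒜) (Finsupp.single c 1) (Finsupp.single c' 1)
  simpa [evolution, Finsupp.single_apply, eq_comm] using this

/-- The transition function of a well-formed machine does not lead to a post-query state. -/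
theorem WellFormed.step_apply_eq_zero (hM : M.WellFormed) (𝒜 : Fin m → Set (List Γ.Sym))
    {c c' : M.Config} {i : Fin m} (hc : ¬ c.IsQuery) (hc' : c'.state = M.post i) :
    M.step 𝒜 c c' = 0 := by
  classical
  -- Relative to the empty oracle a query changes only the state, so this configuration is mapped
  -- exactly to `c'`.
  let d : M.Config := ⟨M.pre i, c'.head, c'.tape⟩
  have hd : M.step (fun _ => ∅) d = Finsupp.single c' 1 := by
    rw [M.step_of_state_eq_pre _ (c := d) (i := i) rfl]
    congr 1
    refine Config.ext' hc'.symm (fun _ => rfl) fun j => ?_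
    simp [Config.query, d, Tape.query_empty]
  have h := hM.cinner_step (fun _ => ∅) d c
  rw [hd, Finsupp.cinner_single_left, Finsupp.single_apply,
    if_neg (by rintro rfl; exact hc ⟨i, rfl⟩)] at h
  -- Without a query the step does not depend on the oracle, so what was shown for the empty oracle
  -- holds for `𝒜`.
  rw [M.step_of_not_isQuery _ hc] at h ⊢
  simpa using h

end OracleQTM

/-! ### Construction of the simulating machine. -/

/-- The alphabet of pairs of a symbol and an optional element of a finite set. -/
def Alphabet.withRegister (Γ : Alphabet.{u}) (S : Type u) [Fintype S] : Alphabet.{u} where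
  Sym := Γ.Sym × Option S
  fintypeSym := inferInstance
  blank := (Γ.blank, none)
  -- The bits have an empty register, so a symbol with a stored state is not a bit and no query can
  -- flip it.
  zero := (Γ.zero, none)
  one := (Γ.one, none)
  zero_ne_blank h := Γ.zero_ne_blank (congrArg Prod.fst h)
  one_ne_blank h := Γ.one_ne_blank (congrArg Prod.fst h)
  zero_ne_one h := Γ.zero_ne_one (congrArg Prod.fst h)

/-- Symbols with an empty second component. -/
def Alphabet.registerInclusion (Γ : Alphabet.{u}) (S : Type u) [Fintype S] :
    Γ.Inclusion (Γ.withRegister S) where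
  toFun a := (a, none)
  injective _ _ h := congrArg Prod.fst h
  map_blank := rfl
  map_zero := rfl
  map_one := rfl

/-- The first components of a tape. -/
def Tape.symbols {Γ : Alphabet.{u}} {S : Type u} [Fintype S] (t : Tape (Γ.withRegister S)) :
    Tape Γ :=
  ⟨fun i => (t.1 i).1, t.2.subset fun _ hi h => hi (congrArg Prod.fst h)⟩

/-- Replace the first components of a tape by the symbols of another tape. -/
def Tape.overlay {Γ : Alphabet.{u}} {S : Type u} [Fintype S] (t : Tape (Γ.withRegister S))
    (s : Tape Γ) : Tape (Γ.withRegister S) :=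
  ⟨fun i => (s.1 i, (t.1 i).2), by
    refine (t.2.union s.2).subset fun i hi => ?_
    by_contra h
    rw [Set.mem_union, not_or] at h
    have h1 : t.1 i = (Γ.blank, none) := not_not.1 h.1
    have h2 : s.1 i = Γ.blank := not_not.1 h.2
    have h3 : (t.1 i).2 = none := congrArg (fun a : Γ.Sym × Option S => a.2) h1
    exact hi (Prod.ext h2 h3)⟩

/-- Separates what `M` writes from the registers, which a simulated step has to preserve. -/
theorem Tape.write_eq_overlay {Γ : Alphabet.{u}} {S : Type u} [Fintype S]
    (t : Tape (Γ.withRegister S)) (i : ℤ) (a : Γ.Sym) :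
    t.write i ((a, (t.1 i).2) : Γ.Sym × Option S) = t.overlay (t.symbols.write i a) := by
  refine Tape.ext fun j => ?_
  by_cases hj : j = i
  · subst hj
    exact (write_apply_self ..).trans (Prod.ext (write_apply_self t.symbols j a).symm rfl)
  · exact (write_apply_of_ne _ _ hj).trans
      (Prod.ext (write_apply_of_ne t.symbols a hj).symm rfl)

namespace OracleQTM

variable {Γ : Alphabet.{u}} {k : ℕ} (M : OracleQTM Γ k 1)

/-- The alphabet whose symbols can additionally store a state of `M`. -/
abbrev StateAlphabet : Alphabet.{u} := Γ.withRegister M.State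

/-- The inclusion of the alphabet of `M` into the one which can store states. -/
abbrev stateInclusion : Γ.Inclusion M.StateAlphabet := Γ.registerInclusion M.State

/-- Scanned symbols of the simulating machine. -/
abbrev Window : Type u := Fin (k + 2) → M.StateAlphabet.Sym

open Classical in
/-- Exchange the control register with a tape register, unless the state involved is `p`. -/
noncomputable def exchange {S : Type u} (p : S) : Option S × Option S → Option S × Option S
  | (some q, none) => if q = p then (some q, none) else (none, some q)
  | (none, some q) => if q = p then (none, some q) else (some q, none)
  -- Pairs with both registers full or both empty are fixed, which makes the map an involution on
  -- all pairs.
  | x => x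

theorem exchange_exchange {S : Type u} (p : S) (x : Option S × Option S) :
    exchange p (exchange p x) = x := by
  classical
  rcases x with ⟨_ | q, _ | r⟩
  · rfl
  · by_cases h : r = p <;> simp [exchange, h]
  · by_cases h : q = p <;> simp [exchange, h]
  · rfl

/-- The outcome of a simulated transition of `M`. -/
def simulatedOutcome (σ : M.Window)
    (o : M.State × (Fin (k + 1) → Γ.Sym) × (Fin (k + 1) → Dir)) :
    (Option M.State × Fin 7) × M.Window × (Fin (k + 2) → Dir) :=
  ((some o.1, 1),
    Fin.snoc (α := fun _ => M.StateAlphabet.Sym) (fun i => (o.2.1 i, (σ i.castSucc).2))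
      (σ (Fin.last (k + 1))),
    Fin.snoc (α := fun _ => Dir) o.2.2 Dir.N)

/-- The contents of the two registers after a deterministic transition in phase `r`. -/
noncomputable def nextRegisters {S : Type u} (p : S) (r : Fin 7)
    (x : Option S × Option S) : Option S × Option S :=
  if r = 1 ∨ r = 3 then exchange p x else x

theorem nextRegisters_nextRegisters {S : Type u} (p : S) (r : Fin 7)
    (x : Option S × Option S) :
    nextRegisters p r (nextRegisters p r x) = x := by
  unfold nextRegisters
  split_ifs
  · exact exchange_exchange p x
  · rfl

/-- The outcome of a deterministic transition. In the phases `1` and `3` the control register is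
exchanged with the register on the second query tape; otherwise only the phase changes. -/
noncomputable def bookkeepingOutcome (s : Option M.State × Fin 7) (σ : M.Window) :
    (Option M.State × Fin 7) × M.Window × (Fin (k + 2) → Dir) :=
  let x := nextRegisters (M.post 0) s.2 (s.1, (σ (Fin.last (k + 1))).2)
  ((x.1, s.2 + 1), Function.update σ (Fin.last (k + 1)) ((σ (Fin.last (k + 1))).1, x.2),
    fun _ => .N)

/-- The machine that simulates each step of `M` by seven steps, exactly one of which is a query:
a query of `M` is made in phase `0`; if `M` makes no query, then the state of `M` is stored on the
second query tape during a query in phase `2` which has no effect. -/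
noncomputable def uniformQuery : OracleQTM M.StateAlphabet k 2 where
  State := Option M.State × Fin 7
  fintypeState := inferInstance
  init := (some M.init, 0)
  final := {s | ∃ q ∈ M.final, s = (some q, 0)}
  -- After a query of `M` the exchange is skipped and the control in phase 2 is `some (M.post 0)`,
  -- so the second query is not triggered.
  pre := ![(some (M.pre 0), 0), (none, 2)]
  post := ![(some (M.post 0), 1), (none, 3)]
  pre_injective := by
    intro i j h
    fin_cases i <;> fin_cases j <;> simp at h ⊢
  post_injective := by
    intro i j h
    fin_cases i <;> fin_cases j <;> simp at h ⊢
  pre_ne_post := by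
    intro i j
    fin_cases i <;> fin_cases j <;> simp
  pre_notMem_final := by
    intro i
    fin_cases i
    · rintro ⟨q, hq, h⟩
      obtain rfl : M.pre 0 = q := by simpa using h
      exact M.pre_notMem_final 0 hq
    · simp
  δ s σ o' :=
    if s.2 = 0 then
      match s.1 with
      -- The pushforward of the amplitudes of `M` along `simulatedOutcome σ`.
      | some q => ∑ o, Set.indicator {M.simulatedOutcome σ o}
          (fun _ => M.δ q (fun i => (σ i.castSucc).1) o) o'
      -- Encoded configurations have a nonempty control in phase 0. This case is there because the
      -- norm must be preserved on all configurations.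
      | none => Set.indicator {M.bookkeepingOutcome s σ} 1 o'
    else Set.indicator {M.bookkeepingOutcome s σ} 1 o'

variable {M}

/-- The control register of the simulating machine. -/
def Config.control (c : M.uniformQuery.Config) : Option M.State := c.state.1

/-- The phase of the simulating machine. -/
def Config.phase (c : M.uniformQuery.Config) : Fin 7 := c.state.2

theorem isQuery_iff {c : M.Config} : c.IsQuery ↔ c.state = M.pre 0 := by
  constructor
  · rintro ⟨i, h⟩
    rwa [Subsingleton.elim i 0] at h
  · exact fun h => ⟨0, h⟩

theorem uniformQuery_state_eq_pre_zero {c : M.uniformQuery.Config} :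
    c.state = M.uniformQuery.pre 0 ↔ c.control = some (M.pre 0) ∧ c.phase = 0 :=
  Prod.ext_iff

theorem uniformQuery_state_eq_pre_one {c : M.uniformQuery.Config} :
    c.state = M.uniformQuery.pre 1 ↔ c.control = none ∧ c.phase = 2 :=
  Prod.ext_iff

theorem uniformQuery_isQuery_iff {c : M.uniformQuery.Config} :
    c.IsQuery ↔ (c.control = some (M.pre 0) ∧ c.phase = 0) ∨ (c.control = none ∧ c.phase = 2) :=
  Fin.exists_fin_two.trans
    (or_congr uniformQuery_state_eq_pre_zero uniformQuery_state_eq_pre_one)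

theorem Config.ext_uniformQuery {c c' : M.uniformQuery.Config} (h1 : c.control = c'.control)
    (h2 : c.phase = c'.phase) (h3 : ∀ i : Fin (k + 1), c.head i.castSucc = c'.head i.castSucc)
    (h4 : c.head (Fin.last (k + 1)) = c'.head (Fin.last (k + 1)))
    (h5 : ∀ i : Fin (k + 1), c.tape i.castSucc = c'.tape i.castSucc)
    (h6 : c.tape (Fin.last (k + 1)) = c'.tape (Fin.last (k + 1))) : c = c' :=
  Config.ext' (Prod.ext h1 h2) (Fin.forall_fin_succ'.2 ⟨h3, h4⟩)
    (Fin.forall_fin_succ'.2 ⟨h5, h6⟩)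

/-- Allows a step to be computed from a parametrization `f` of its branches instead of a sum over
all transitions; `f` need not be injective. -/
theorem step_eq_sum {Γ' : Alphabet.{u}} {m : ℕ} {N : OracleQTM Γ' k m}
    (𝒜 : Fin m → Set (List Γ'.Sym)) {c : N.Config} (hc : ¬ c.IsQuery) {J : Type*} [Fintype J]
    (f : J → N.State × (Fin (k + m) → Γ'.Sym) × (Fin (k + m) → Dir)) (a : J → ℂ)
    (hδ : ∀ o, N.δ c.state c.scan o = ∑ j, Set.indicator {f j} (fun _ => a j) o) :
    N.step 𝒜 c = ∑ j, Finsupp.single (c.move (f j)) (a j) := by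
  classical
  rw [step_of_not_isQuery _ _ hc]
  simp only [hδ, Finsupp.single_finsetSum]
  rw [Finset.sum_comm]
  refine Finset.sum_congr rfl fun j _ => ?_
  rw [Finset.sum_eq_single (f j)]
  · simp
  · intro o _ h
    simp [h]
  · simp

theorem uniformQuery_step_bookkeeping (𝒜 : Fin 2 → Set (List M.StateAlphabet.Sym))
    {c : M.uniformQuery.Config} (hq : ¬ c.IsQuery) (h : c.control = none ∨ c.phase ≠ 0) :
    M.uniformQuery.step 𝒜 c =
      Finsupp.single (c.move (M.bookkeepingOutcome c.state c.scan)) 1 := by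
  classical
  rw [step_eq_sum 𝒜 hq (fun _ : Unit => M.bookkeepingOutcome c.state c.scan) 1]
  · simp
  · intro o
    rw [Fintype.sum_unique]
    by_cases h0 : c.phase = 0
    · have h1 : c.state.1 = none := h.resolve_right (not_not.2 h0)
      refine (if_pos h0).trans ?_
      rw [h1]
      rfl
    · exact if_neg h0

/-! ### Simulated steps: the data visible to `M` and the hidden rest. -/

/-- The part of a configuration of the simulating machine that is seen by `M` in state `q`. -/
def Config.visible (b : M.uniformQuery.Config) (q : M.State) : M.Config where
  state := q
  head i := b.head i.castSucc
  tape i := (b.tape i.castSucc).symbols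

/-- The result of replacing in `b` the part that is seen by `M` by the configuration `c`, after
a simulated step. -/
def Config.replace (b : M.uniformQuery.Config) (c : M.Config) : M.uniformQuery.Config where
  state := ((some c.state, 1) : Option M.State × Fin 7)
  head := Fin.snoc (α := fun _ => ℤ) c.head (b.head (Fin.last (k + 1)))
  tape := Fin.snoc (α := fun _ => Tape M.StateAlphabet)
    (fun i => (b.tape i.castSucc).overlay (c.tape i)) (b.tape (Fin.last (k + 1)))

section replace

variable (b : M.uniformQuery.Config) (c : M.Config)

theorem Config.control_replace : (b.replace c).control = some c.state := rfl

theorem Config.head_replace_castSucc (i : Fin (k + 1)) :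
    (b.replace c).head i.castSucc = c.head i :=
  Fin.snoc_castSucc (α := fun _ => ℤ) ..

theorem Config.head_replace_last :
    (b.replace c).head (Fin.last (k + 1)) = b.head (Fin.last (k + 1)) :=
  Fin.snoc_last (α := fun _ => ℤ) ..

theorem Config.tape_replace_castSucc (i : Fin (k + 1)) :
    (b.replace c).tape i.castSucc = (b.tape i.castSucc).overlay (c.tape i) :=
  Fin.snoc_castSucc (α := fun _ => Tape M.StateAlphabet) (b.tape (Fin.last (k + 1)))
    (fun i => (b.tape i.castSucc).overlay (c.tape i)) i

theorem Config.tape_replace_last :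
    (b.replace c).tape (Fin.last (k + 1)) = b.tape (Fin.last (k + 1)) :=
  Fin.snoc_last (α := fun _ => Tape M.StateAlphabet) (b.tape (Fin.last (k + 1)))
    (fun i => (b.tape i.castSucc).overlay (c.tape i))

theorem Config.visible_replace : (b.replace c).visible c.state = c := by
  refine Config.ext' rfl (b.head_replace_castSucc c) fun i => ?_
  simp only [visible, tape_replace_castSucc]
  rfl

end replace

theorem Config.replace_injective (b : M.uniformQuery.Config) :
    Function.Injective b.replace := by
  intro c c' h
  have hs : c.state = c'.state := Option.some_injective _ (congrArg Config.control h)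
  rw [← b.visible_replace c, ← b.visible_replace c', h, hs]

/-- The data hidden from `M` survive a simulated step. Thus base configurations with different
hidden data have disjoint images. -/
theorem Config.replace_eq_of_replace_eq {b b' : M.uniformQuery.Config} {c c' : M.Config}
    (h : b.replace c = b'.replace c') :
    b.head (Fin.last (k + 1)) = b'.head (Fin.last (k + 1)) ∧
    b.tape (Fin.last (k + 1)) = b'.tape (Fin.last (k + 1)) ∧
    ∀ (i : Fin (k + 1)) (j : ℤ), ((b.tape i.castSucc).1 j).2 = ((b'.tape i.castSucc).1 j).2 := by
  refine ⟨?_, ?_, fun i j => ?_⟩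
  · rw [← b.head_replace_last c, h, head_replace_last]
  · rw [← b.tape_replace_last c, h, tape_replace_last]
  · have : ((b.replace c).tape i.castSucc).1 j = ((b'.replace c').tape i.castSucc).1 j := by
      rw [h]
    rw [tape_replace_castSucc, tape_replace_castSucc] at this
    have h2 := congrArg (fun a : Γ.Sym × Option M.State => a.2) this
    exact h2

/-- Only the hidden data of the base configuration enter `replace`. This complements
`replace_eq_of_replace_eq`: the ranges of two such maps are either disjoint or come from one and the
same map. -/
theorem Config.replace_congr {b b' : M.uniformQuery.Config}
    (h : b.head (Fin.last (k + 1)) = b'.head (Fin.last (k + 1)) ∧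
      b.tape (Fin.last (k + 1)) = b'.tape (Fin.last (k + 1)) ∧
      ∀ (i : Fin (k + 1)) (j : ℤ),
        ((b.tape i.castSucc).1 j).2 = ((b'.tape i.castSucc).1 j).2) :
    b.replace = b'.replace := by
  funext c
  refine Config.ext_uniformQuery rfl rfl (fun i => ?_) ?_ (fun i => ?_) ?_
  · rw [head_replace_castSucc, head_replace_castSucc]
  · rw [head_replace_last, head_replace_last, h.1]
  · rw [tape_replace_castSucc, tape_replace_castSucc]
    exact Tape.ext fun j => Prod.ext rfl (h.2.2 i j)
  · rw [tape_replace_last, tape_replace_last, h.2.1]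

theorem Config.move_simulatedOutcome (b : M.uniformQuery.Config) (q : M.State)
    (o : M.State × (Fin (k + 1) → Γ.Sym) × (Fin (k + 1) → Dir)) :
    b.move (M.simulatedOutcome b.scan o) = b.replace ((b.visible q).move o) := by
  refine Config.ext_uniformQuery rfl rfl (fun i => ?_) ?_ (fun i => ?_) ?_
  · rw [head_replace_castSucc]
    refine congrArg (fun d : Dir => b.head i.castSucc + d.shift) ?_
    exact Fin.snoc_castSucc (α := fun _ => Dir) ..
  · rw [head_replace_last]
    refine (congrArg (fun d : Dir => b.head (Fin.last (k + 1)) + d.shift)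
      (Fin.snoc_last (α := fun _ => Dir) Dir.N o.2.2)).trans ?_
    exact add_zero _
  · rw [tape_replace_castSucc]
    refine (congrArg ((b.tape i.castSucc).write (b.head i.castSucc))
      (Fin.snoc_castSucc (α := fun _ => M.StateAlphabet.Sym) (b.scan (Fin.last (k + 1)))
        (fun i => (o.2.1 i, (b.scan i.castSucc).2)) i)).trans ?_
    exact Tape.write_eq_overlay _ _ _
  · rw [tape_replace_last]
    refine (congrArg ((b.tape (Fin.last (k + 1))).write (b.head (Fin.last (k + 1))))
      (Fin.snoc_last (α := fun _ => M.StateAlphabet.Sym) (b.scan (Fin.last (k + 1)))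
        (fun i => (o.2.1 i, (b.scan i.castSucc).2)))).trans ?_
    exact Tape.write_self _ _

/-- The simulation of a step of `M`. -/
theorem uniformQuery_step_simulated (𝒜 : Fin 2 → Set (List M.StateAlphabet.Sym))
    (ℬ : Fin 1 → Set (List Γ.Sym)) {b : M.uniformQuery.Config} {q : M.State}
    (hb : b.control = some q) (hb0 : b.phase = 0) (hq : q ≠ M.pre 0) :
    M.uniformQuery.step 𝒜 b = Finsupp.mapDomain b.replace (M.step ℬ (b.visible q)) := by
  classical
  have hb1 : ¬ b.IsQuery := by
    rw [uniformQuery_isQuery_iff, hb, hb0]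
    simpa using hq
  have hb2 : ¬ (b.visible q).IsQuery := by rwa [isQuery_iff]
  rw [step_eq_sum 𝒜 hb1 (M.simulatedOutcome b.scan) (M.δ q (b.visible q).scan),
    step_of_not_isQuery _ _ hb2]
  · simp only [Finsupp.mapDomain_finsetSum, Finsupp.mapDomain_single,
      Config.move_simulatedOutcome b q]
    rfl
  · intro o
    refine (if_pos hb0).trans ?_
    rw [show b.state.1 = some q from hb]
    rfl

end OracleQTM

/-- For deterministic steps, orthonormality reduces to injectivity on configurations. -/
theorem Finsupp.cinner_eq_single_of_single {α β : Type*} {v : α → β →₀ ℂ} {c c' : α} {d d' : β}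
    (h : v c = Finsupp.single d 1) (h' : v c' = Finsupp.single d' 1) (hd : d = d' → c = c') :
    Finsupp.cinner (v c) (v c') = Finsupp.single c (1 : ℂ) c' := by
  classical
  by_cases hc : c = c'
  · subst hc
    simp [h]
  · rw [h, h', Finsupp.cinner_single_left, Finsupp.single_eq_of_ne (fun hd' => hc (hd hd')),
      Finsupp.single_eq_of_ne (Ne.symm hc), mul_zero]

/-! ### Well-formedness of the simulating machine. -/

namespace OracleQTM

variable {Γ : Alphabet.{u}} {k : ℕ} {M : OracleQTM Γ k 1}

/-- The contents of the control register and of the register scanned on the second query tape. -/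
def Config.registers (c : M.uniformQuery.Config) : Option M.State × Option M.State :=
  (c.control, ((c.tape (Fin.last (k + 1))).1 (c.head (Fin.last (k + 1)))).2)

/-- The successor of a configuration under a deterministic transition. -/
noncomputable def Config.bookkeep (c : M.uniformQuery.Config) : M.uniformQuery.Config :=
  c.move (M.bookkeepingOutcome c.state c.scan)

section bookkeep

variable (c : M.uniformQuery.Config)

theorem Config.phase_bookkeep : c.bookkeep.phase = c.phase + 1 := rfl

theorem Config.control_bookkeep :
    c.bookkeep.control = (nextRegisters (M.post 0) c.phase c.registers).1 := rfl

theorem Config.head_bookkeep (i : Fin (k + 2)) : c.bookkeep.head i = c.head i :=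
  add_zero _

theorem Config.tape_bookkeep_castSucc (i : Fin (k + 1)) :
    c.bookkeep.tape i.castSucc = c.tape i.castSucc :=
  (congrArg ((c.tape i.castSucc).write (c.head i.castSucc))
    (Function.update_of_ne (Fin.castSucc_lt_last i).ne _ c.scan)).trans (Tape.write_self _ _)

theorem Config.tape_bookkeep_last :
    c.bookkeep.tape (Fin.last (k + 1)) =
      (c.tape (Fin.last (k + 1))).write (c.head (Fin.last (k + 1)))
        ((c.scan (Fin.last (k + 1))).1, (nextRegisters (M.post 0) c.phase c.registers).2) :=
  congrArg ((c.tape (Fin.last (k + 1))).write (c.head (Fin.last (k + 1))))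
    (Function.update_self (Fin.last (k + 1)) _ c.scan)

/-- The heads do not move, so the register scanned afterwards is the one just written. -/
theorem Config.registers_bookkeep :
    c.bookkeep.registers = nextRegisters (M.post 0) c.phase c.registers := by
  refine Prod.ext c.control_bookkeep ?_
  simp only [registers, tape_bookkeep_last, head_bookkeep]
  exact congrArg Prod.snd (Tape.write_apply_self (c.tape (Fin.last (k + 1))) _ _)

end bookkeep

/-- The phase is shifted by one, the two registers undergo an involution determined by the phase,
and everything else stays. -/
theorem Config.bookkeep_injective :
    Function.Injective (Config.bookkeep : M.uniformQuery.Config → M.uniformQuery.Config) := by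
  intro c c' h
  have hphase : c.phase = c'.phase := by
    have := congrArg Config.phase h
    rw [phase_bookkeep, phase_bookkeep] at this
    exact add_right_cancel this
  have hreg : c.registers = c'.registers := by
    have := congrArg Config.registers h
    rw [registers_bookkeep, registers_bookkeep, hphase] at this
    -- Applying the involution once more recovers the old registers.
    rw [← nextRegisters_nextRegisters (M.post 0) c'.phase c.registers, this,
      nextRegisters_nextRegisters]
  have hhead : ∀ i, c.head i = c'.head i := fun i => by
    rw [← c.head_bookkeep, h, head_bookkeep]
  refine Config.ext_uniformQuery 
    (congrArg (fun x : Option M.State × Option M.State => x.1) hreg) hphase (fun i => hhead _) (hhead _)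
    (fun i => ?_) ?_
  · rw [← c.tape_bookkeep_castSucc, h, tape_bookkeep_castSucc]
  · have ht : c.bookkeep.tape (Fin.last (k + 1)) = c'.bookkeep.tape (Fin.last (k + 1)) := by
      rw [h]
    rw [tape_bookkeep_last, tape_bookkeep_last, ← hhead] at ht
    refine Tape.ext fun j => ?_
    have hj := congrArg (fun t : Tape M.StateAlphabet => t.1 j) ht
    by_cases hji : j = c.head (Fin.last (k + 1))
    · subst hji
      have h0 := ((Tape.write_apply_self ..).symm.trans hj).trans (Tape.write_apply_self ..)
      have h1 := congrArg (fun a : Γ.Sym × Option M.State => a.1) h0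
      have h2 := congrArg (fun x : Option M.State × Option M.State => x.2) hreg
      simp only [registers, ← hhead] at h2
      simp only [scan, ← hhead] at h1
      exact Prod.ext h1 h2
    · exact ((Tape.write_apply_of_ne _ _ hji).symm.trans hj).trans
        (Tape.write_apply_of_ne _ _ hji)

theorem uniformQuery_step_query_zero (𝒜 : Fin 2 → Set (List M.StateAlphabet.Sym))
    {c : M.uniformQuery.Config} (h1 : c.control = some (M.pre 0)) (h2 : c.phase = 0) :
    M.uniformQuery.step 𝒜 c = Finsupp.single (c.query 0 (𝒜 0)) 1 :=
  step_of_state_eq_pre _ _ (uniformQuery_state_eq_pre_zero.2 ⟨h1, h2⟩)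

theorem uniformQuery_step_query_one (𝒜 : Fin 2 → Set (List M.StateAlphabet.Sym))
    {c : M.uniformQuery.Config} (h1 : c.control = none) (h2 : c.phase = 2) :
    M.uniformQuery.step 𝒜 c = Finsupp.single (c.query 1 (𝒜 1)) 1 :=
  step_of_state_eq_pre _ _ (uniformQuery_state_eq_pre_one.2 ⟨h1, h2⟩)

/-- The kinds of configurations of the simulating machine: a query to either oracle, a simulated
transition or a deterministic transition. -/
theorem uniformQuery_cases (c : M.uniformQuery.Config) :
    (c.control = some (M.pre 0) ∧ c.phase = 0) ∨ (c.control = none ∧ c.phase = 2) ∨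
    (∃ q, c.control = some q ∧ c.phase = 0 ∧ q ≠ M.pre 0) ∨
    (¬ c.IsQuery ∧ (c.control = none ∨ c.phase ≠ 0)) := by
  rw [uniformQuery_isQuery_iff]
  by_cases h0 : c.phase = 0
  · rcases hc : c.control with _ | q
    · right; right; right
      simp [h0]
    · by_cases hq : q = M.pre 0
      · left
        simp [hq, h0]
      · right; right; left
        exact ⟨q, rfl, h0, hq⟩
  · by_cases h2 : c.control = none ∧ c.phase = 2
    · exact Or.inr (Or.inl h2)
    · right; right; right
      tauto

/-- Makes steps from different phases orthogonal, so that well-formedness can be checked phase by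
phase. -/
theorem uniformQuery_phase_of_step (𝒜 : Fin 2 → Set (List M.StateAlphabet.Sym))
    {c d : M.uniformQuery.Config} (h : M.uniformQuery.step 𝒜 c d ≠ 0) :
    d.phase = c.phase + 1 := by
  classical
  have key : ∀ e : M.uniformQuery.Config, M.uniformQuery.step 𝒜 c = Finsupp.single e 1 → e = d := by
    intro e he
    by_contra hne
    rw [he, Finsupp.single_eq_of_ne (Ne.symm hne)] at h
    exact h rfl
  rcases uniformQuery_cases c with ⟨h1, h2⟩ | ⟨h1, h2⟩ | ⟨q, h1, h2, h3⟩ | ⟨h1, h2⟩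
  · rw [← key _ (uniformQuery_step_query_zero 𝒜 h1 h2), h2]
    rfl
  · rw [← key _ (uniformQuery_step_query_one 𝒜 h1 h2), h2]
    rfl
  · rw [uniformQuery_step_simulated 𝒜 (fun _ => ∅) h1 h2 h3] at h
    by_cases hd : d ∈ Set.range c.replace
    · obtain ⟨e, rfl⟩ := hd
      rw [h2]
      rfl
    · exact absurd (Finsupp.mapDomain_of_notMem_range _ _ hd) h
  · rw [← key _ (uniformQuery_step_bookkeeping 𝒜 h1 h2)]
    exact c.phase_bookkeep

/-- If the two images can meet, the hidden data agree, both steps are pushforwards along one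
injection, and the inner product is that of two steps of `M`. Otherwise the supports are disjoint.
-/
theorem cinner_simulated_simulated (hM : M.WellFormed)
    (𝒜 : Fin 2 → Set (List M.StateAlphabet.Sym)) {b b' : M.uniformQuery.Config} {q q' : M.State}
    (h1 : b.control = some q) (h2 : b.phase = 0) (h3 : q ≠ M.pre 0)
    (h1' : b'.control = some q') (h2' : b'.phase = 0) (h3' : q' ≠ M.pre 0) :
    Finsupp.cinner (M.uniformQuery.step 𝒜 b) (M.uniformQuery.step 𝒜 b') =
      Finsupp.single b (1 : ℂ) b' := by
  classical
  rw [uniformQuery_step_simulated 𝒜 (fun _ => ∅) h1 h2 h3,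
    uniformQuery_step_simulated 𝒜 (fun _ => ∅) h1' h2' h3']
  by_cases hr : ∃ c c', b.replace c = b'.replace c'
  · obtain ⟨c, c', hcc⟩ := hr
    have hb := Config.replace_eq_of_replace_eq hcc
    rw [Config.replace_congr hb, Finsupp.cinner_mapDomain b'.replace_injective, hM.cinner_step]
    have key : b.visible q = b'.visible q' ↔ b = b' := by
      constructor
      · intro hv
        have hq : q = q' := congrArg Config.state hv
        refine Config.ext_uniformQuery (by rw [h1, h1', hq]) (h2.trans h2'.symm)
          (fun i => congrFun (congrArg Config.head hv) i) hb.1 (fun i => ?_) hb.2.1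
        have ht := congrFun (congrArg Config.tape hv) i
        refine Tape.ext fun j => Prod.ext ?_ (hb.2.2 i j)
        exact congrArg (fun t : Tape Γ => t.1 j) ht
      · rintro rfl
        have hq : q = q' := Option.some_injective _ (h1.symm.trans h1')
        rw [hq]
    simp only [Finsupp.single_apply, key]
  · rw [Finsupp.single_eq_of_ne (by
      rintro rfl
      exact hr ⟨b'.visible q, b'.visible q, rfl⟩)]
    refine Finsupp.cinner_eq_zero_of_disjoint fun d hd => ?_
    by_cases hd1 : d ∈ Set.range b.replace
    · refine Finsupp.mapDomain_of_notMem_range _ _ ?_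
      rintro ⟨e', he'⟩
      obtain ⟨e, rfl⟩ := hd1
      exact hr ⟨e, e', he'.symm⟩
    · exact absurd (Finsupp.mapDomain_of_notMem_range _ _ hd1) hd

/-- A simulated step leaves a state of `M` in the control, and well-formedness of `M` prevents that
state from being the post-query state. -/
theorem simulated_apply_eq_zero_of_control (hM : M.WellFormed) {b d : M.uniformQuery.Config}
    {q : M.State} (hq : q ≠ M.pre 0) (hd : d.control = some (M.post 0) ∨ d.control = none) :
    Finsupp.mapDomain b.replace (M.step (fun _ => ∅) (b.visible q)) d = 0 := by
  by_cases hd1 : d ∈ Set.range b.replace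
  · obtain ⟨e, rfl⟩ := hd1
    rw [Finsupp.mapDomain_apply b.replace_injective]
    refine hM.step_apply_eq_zero _ (i := 0) (by rwa [isQuery_iff]) ?_
    simpa [Config.control_replace] using hd
  · exact Finsupp.mapDomain_of_notMem_range _ _ hd1

/-- The simulating machine is well-formed. -/
theorem uniformQuery_wellFormed (hM : M.WellFormed) : M.uniformQuery.WellFormed := by
  classical
  intro 𝒜
  refine Finsupp.sum_norm_sq_linearCombination fun c c' => ?_
  by_cases hp : c.phase = c'.phase
  swap
  · rw [Finsupp.single_eq_of_ne (by rintro rfl; exact hp rfl)]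
    refine Finsupp.cinner_eq_zero_of_disjoint fun d hd => ?_
    by_contra hd'
    exact hp (add_right_cancel
      ((uniformQuery_phase_of_step 𝒜 hd).symm.trans (uniformQuery_phase_of_step 𝒜 hd')))
  have hsymm : ∀ e e' : M.uniformQuery.Config,
      Finsupp.cinner (M.uniformQuery.step 𝒜 e) (M.uniformQuery.step 𝒜 e') =
        Finsupp.single e (1 : ℂ) e' →
      Finsupp.cinner (M.uniformQuery.step 𝒜 e') (M.uniformQuery.step 𝒜 e) =
        Finsupp.single e' (1 : ℂ) e := by
    intro e e' h
    rw [← Finsupp.star_cinner, h]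
    simp only [Finsupp.single_apply, eq_comm (a := e)]
    split_ifs <;> simp
  have hctrl : ∀ e : M.uniformQuery.Config, e.phase ≠ 1 → e.phase ≠ 3 →
      e.bookkeep.control = e.control := by
    intro e h1 h3
    rw [Config.control_bookkeep, nextRegisters, if_neg (by tauto)]
    rfl
  -- In phase 0 a query ends with control `some (M.post 0)` and a deterministic transition with
  -- control `none`; simulated steps reach neither.
  have hQS : ∀ (e e' : M.uniformQuery.Config) (d : M.uniformQuery.Config) (q : M.State),
      M.uniformQuery.step 𝒜 e = Finsupp.single d 1 →
      (d.control = some (M.post 0) ∨ d.control = none) →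
      e'.control = some q → e'.phase = 0 → q ≠ M.pre 0 → e ≠ e' →
      Finsupp.cinner (M.uniformQuery.step 𝒜 e) (M.uniformQuery.step 𝒜 e') =
        Finsupp.single e (1 : ℂ) e' := by
    intro e e' d q h hd h1 h2 h3 hne
    rw [h, uniformQuery_step_simulated 𝒜 (fun _ => ∅) h1 h2 h3, Finsupp.cinner_single_left,
      simulated_apply_eq_zero_of_control hM h3 hd, Finsupp.single_eq_of_ne (Ne.symm hne),
      mul_zero]
  have hQ0S : ∀ (e e' : M.uniformQuery.Config) (q : M.State),
      e.control = some (M.pre 0) → e.phase = 0 →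
      e'.control = some q → e'.phase = 0 → q ≠ M.pre 0 →
      Finsupp.cinner (M.uniformQuery.step 𝒜 e) (M.uniformQuery.step 𝒜 e') =
        Finsupp.single e (1 : ℂ) e' := by
    intro e e' q h1 h2 h1' h2' h3'
    refine hQS e e' _ q (uniformQuery_step_query_zero 𝒜 h1 h2) (Or.inl rfl) h1' h2' h3' ?_
    rintro rfl
    exact h3' (Option.some_injective _ (h1'.symm.trans h1))
  have hBS : ∀ (e e' : M.uniformQuery.Config) (q : M.State),
      ¬ e.IsQuery → (e.control = none ∨ e.phase ≠ 0) → e.phase = e'.phase →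
      e'.control = some q → e'.phase = 0 → q ≠ M.pre 0 →
      Finsupp.cinner (M.uniformQuery.step 𝒜 e) (M.uniformQuery.step 𝒜 e') =
        Finsupp.single e (1 : ℂ) e' := by
    intro e e' q h1 h2 hp h1' h2' h3'
    have h0 : e.phase = 0 := hp.trans h2'
    have hn : e.control = none := h2.resolve_right (not_not.2 h0)
    refine hQS e e' _ q (uniformQuery_step_bookkeeping 𝒜 h1 h2) (Or.inr ?_) h1' h2' h3' ?_
    · exact (hctrl e (by simp [h0]) (by simp [h0])).trans hn
    · rintro rfl
      rw [hn] at h1'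
      cases h1'
  have hQ0B : ∀ e e' : M.uniformQuery.Config, e.control = some (M.pre 0) → e.phase = 0 →
      ¬ e'.IsQuery → (e'.control = none ∨ e'.phase ≠ 0) → e.phase = e'.phase →
      Finsupp.cinner (M.uniformQuery.step 𝒜 e) (M.uniformQuery.step 𝒜 e') =
        Finsupp.single e (1 : ℂ) e' := by
    intro e e' h1 h2 h1' h2' hp
    have h0 : e'.phase = 0 := hp.symm.trans h2
    have hn : e'.control = none := h2'.resolve_right (not_not.2 h0)
    refine Finsupp.cinner_eq_single_of_single (uniformQuery_step_query_zero 𝒜 h1 h2)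
      (uniformQuery_step_bookkeeping 𝒜 h1' h2') fun h => ?_
    have := congrArg Config.control h
    have h4 := (hctrl e' (by simp [h0]) (by simp [h0])).trans hn
    exact absurd (this.trans h4) (Option.some_ne_none (M.post 0))
  -- In phase 2 the query ends with empty control, whereas a deterministic transition keeps its
  -- control, which is nonempty since it is not a query.
  have hQ1B : ∀ e e' : M.uniformQuery.Config, e.control = none → e.phase = 2 →
      ¬ e'.IsQuery → (e'.control = none ∨ e'.phase ≠ 0) → e.phase = e'.phase →
      Finsupp.cinner (M.uniformQuery.step 𝒜 e) (M.uniformQuery.step 𝒜 e') =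
        Finsupp.single e (1 : ℂ) e' := by
    intro e e' h1 h2 h1' h2' hp
    have h0 : e'.phase = 2 := hp.symm.trans h2
    refine Finsupp.cinner_eq_single_of_single (uniformQuery_step_query_one 𝒜 h1 h2)
      (uniformQuery_step_bookkeeping 𝒜 h1' h2') fun h => ?_
    have := congrArg Config.control h
    have h4 := hctrl e' (by simp [h0]) (by simp [h0])
    exact absurd (uniformQuery_isQuery_iff.2 (Or.inr ⟨h4.symm.trans this.symm, h0⟩)) h1'
  have h02 : (0 : Fin 7) ≠ 2 := by decide
  rcases uniformQuery_cases c with ⟨h1, h2⟩ | ⟨h1, h2⟩ | ⟨q, h1, h2, h3⟩ | ⟨h1, h2⟩ <;>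
    rcases uniformQuery_cases c' with
      ⟨h1', h2'⟩ | ⟨h1', h2'⟩ | ⟨q', h1', h2', h3'⟩ | ⟨h1', h2'⟩
  · exact Finsupp.cinner_eq_single_of_single (uniformQuery_step_query_zero 𝒜 h1 h2)
      (uniformQuery_step_query_zero 𝒜 h1' h2') (Config.query_injective
        (uniformQuery_state_eq_pre_zero.2 ⟨h1, h2⟩) (uniformQuery_state_eq_pre_zero.2 ⟨h1', h2'⟩))
  · exact absurd (h2.symm.trans (hp.trans h2')) h02
  · exact hQ0S c c' q' h1 h2 h1' h2' h3'
  · exact hQ0B c c' h1 h2 h1' h2' hp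
  · exact absurd (h2'.symm.trans (hp.symm.trans h2)) h02
  · exact Finsupp.cinner_eq_single_of_single (uniformQuery_step_query_one 𝒜 h1 h2)
      (uniformQuery_step_query_one 𝒜 h1' h2') (Config.query_injective
        (uniformQuery_state_eq_pre_one.2 ⟨h1, h2⟩) (uniformQuery_state_eq_pre_one.2 ⟨h1', h2'⟩))
  · exact absurd (h2'.symm.trans (hp.symm.trans h2)) h02
  · exact hQ1B c c' h1 h2 h1' h2' hp
  · exact hsymm _ _ (hQ0S c' c q h1' h2' h1 h2 h3)
  · exact absurd (h2.symm.trans (hp.trans h2')) h02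
  · exact cinner_simulated_simulated hM 𝒜 h1 h2 h3 h1' h2' h3'
  · exact hsymm _ _ (hBS c' c q h1' h2' hp.symm h1 h2 h3)
  · exact hsymm _ _ (hQ0B c' c h1' h2' h1 h2 hp.symm)
  · exact hsymm _ _ (hQ1B c' c h1' h2' h1 h2 hp.symm)
  · exact hBS c c' q' h1 h2 hp h1' h2' h3'
  · exact Finsupp.cinner_eq_single_of_single (uniformQuery_step_bookkeeping 𝒜 h1 h2)
      (uniformQuery_step_bookkeeping 𝒜 h1' h2') (fun h => Config.bookkeep_injective h)

end OracleQTM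

/-! ### Encoding configurations of `M` in each phase. -/

theorem Tape.ofWord_nil_apply {Γ : Alphabet.{u}} (s i : ℤ) :
    (Tape.ofWord (Γ := Γ) s []).1 i = Γ.blank := by
  rw [ofWord_apply]
  split_ifs <;> rfl

namespace OracleQTM

variable {Γ : Alphabet.{u}} {k : ℕ} {M : OracleQTM Γ k 1}

/-- The registers in phase `r` of the simulation, when `M` is in state `q`: the state is stored on
the second query tape in the phases `2` and `3`, unless `M` has just made a query. -/
noncomputable def simulationRegisters (p : M.State) (r : Fin 7) (q : M.State) :
    Option M.State × Option M.State :=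
  if r = 2 ∨ r = 3 then exchange p (some q, none) else (some q, none)

/-- The exchange in phase 1 parks the state and the one in phase 3 undoes it; the other transitions
leave the registers alone. -/
theorem nextRegisters_simulationRegisters (p : M.State) {r : Fin 7} (hr : r ≠ 2) (q : M.State) :
    nextRegisters p r (simulationRegisters p r q) = simulationRegisters p (r + 1) q := by
  fin_cases r <;> simp [nextRegisters, simulationRegisters, exchange_exchange] at hr ⊢

/-- The configuration of the simulating machine in phase `r` which represents the configuration
`c` of `M`. -/
noncomputable def Config.embed (r : Fin 7) (c : M.Config) : M.uniformQuery.Config where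
  state := (((simulationRegisters (M.post 0) r c.state).1, r) : Option M.State × Fin 7)
  head := Fin.snoc (α := fun _ => ℤ) c.head 0
  tape := Fin.snoc (α := fun _ => Tape M.StateAlphabet)
    (fun i => (c.tape i).lift M.stateInclusion)
    ((Tape.ofWord 0 []).write 0 (Γ.blank, (simulationRegisters (M.post 0) r c.state).2))

section embed

variable (r : Fin 7) (c : M.Config)

theorem Config.control_embed :
    (c.embed r).control = (simulationRegisters (M.post 0) r c.state).1 := rfl

theorem Config.phase_embed : (c.embed r).phase = r := rfl

theorem Config.head_embed_castSucc (i : Fin (k + 1)) :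
    (c.embed r).head i.castSucc = c.head i :=
  Fin.snoc_castSucc (α := fun _ => ℤ) ..

theorem Config.head_embed_last : (c.embed r).head (Fin.last (k + 1)) = 0 :=
  Fin.snoc_last (α := fun _ => ℤ) ..

theorem Config.tape_embed_castSucc (i : Fin (k + 1)) :
    (c.embed r).tape i.castSucc = (c.tape i).lift M.stateInclusion :=
  Fin.snoc_castSucc (α := fun _ => Tape M.StateAlphabet)
    ((Tape.ofWord 0 []).write 0 (Γ.blank, (simulationRegisters (M.post 0) r c.state).2))
    (fun i => (c.tape i).lift M.stateInclusion) i

theorem Config.tape_embed_last :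
    (c.embed r).tape (Fin.last (k + 1)) = (Tape.ofWord 0 []).write 0
      (Γ.blank, (simulationRegisters (M.post 0) r c.state).2) :=
  Fin.snoc_last (α := fun _ => Tape M.StateAlphabet)
    ((Tape.ofWord 0 []).write 0 (Γ.blank, (simulationRegisters (M.post 0) r c.state).2))
    (fun i => (c.tape i).lift M.stateInclusion)

theorem Config.scan_embed_last :
    (c.embed r).scan (Fin.last (k + 1)) =
      ((Γ.blank, (simulationRegisters (M.post 0) r c.state).2) : Γ.Sym × Option M.State) := by
  rw [scan, tape_embed_last, head_embed_last]
  exact Tape.write_apply_self ..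

theorem Config.registers_embed :
    (c.embed r).registers = simulationRegisters (M.post 0) r c.state :=
  Prod.ext rfl (congrArg (fun a : Γ.Sym × Option M.State => a.2) (c.scan_embed_last r))

end embed

theorem Config.embed_zero_injective :
    Function.Injective (Config.embed 0 : M.Config → M.uniformQuery.Config) := by
  intro c c' h
  refine Config.ext' (Option.some_injective _ (congrArg Config.control h)) (fun i => ?_) fun i => ?_
  · rw [← c.head_embed_castSucc 0, h, head_embed_castSucc]
  · apply Tape.lift_injective M.stateInclusion
    rw [← c.tape_embed_castSucc 0, h, tape_embed_castSucc]

theorem Config.bookkeep_embed {r : Fin 7} {c : M.Config}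
    (h : nextRegisters (M.post 0) r (simulationRegisters (M.post 0) r c.state) =
      simulationRegisters (M.post 0) (r + 1) c.state) :
    (c.embed r).bookkeep = c.embed (r + 1) := by
  have hreg : nextRegisters (M.post 0) (c.embed r).phase (c.embed r).registers =
      simulationRegisters (M.post 0) (r + 1) c.state := by
    rw [registers_embed, phase_embed, h]
  refine Config.ext_uniformQuery ?_ rfl (fun i => ?_) ?_ (fun i => ?_) ?_
  · rw [control_bookkeep, hreg, control_embed]
  · rw [head_bookkeep, head_embed_castSucc, head_embed_castSucc]
  · rw [head_bookkeep, head_embed_last, head_embed_last]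
  · rw [tape_bookkeep_castSucc, tape_embed_castSucc, tape_embed_castSucc]
  · rw [tape_bookkeep_last, hreg, tape_embed_last, tape_embed_last, head_embed_last,
      scan_embed_last]
    exact Tape.write_write _ _ _ _

/-- The query tape on which the state of `M` is stored is not changed by a query. -/
theorem query_stored_state (A : Set (List M.StateAlphabet.Sym)) (s : Option M.State) :
    ((Tape.ofWord 0 [] : Tape M.StateAlphabet).write 0 (Γ.blank, s)).query A =
      (Tape.ofWord 0 []).write 0 (Γ.blank, s) := by
  have h : ∀ i, (((Tape.ofWord 0 [] : Tape M.StateAlphabet).write 0 (Γ.blank, s)).1 i).1 =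
      Γ.blank := by
    intro i
    by_cases hi : i = 0
    · subst hi
      have h0 := (Tape.ofWord 0 [] : Tape M.StateAlphabet).write_apply_self 0 (Γ.blank, s)
      exact congrArg (fun a : Γ.Sym × Option M.State => a.1) h0
    · have h0 := ((Tape.ofWord 0 [] : Tape M.StateAlphabet).write_apply_of_ne (Γ.blank, s)
        hi).trans (Tape.ofWord_nil_apply ..)
      exact congrArg (fun a : Γ.Sym × Option M.State => a.1) h0
  refine Tape.query_eq_self A (fun i hi => ?_) fun i hi => ?_
  · exact Γ.zero_ne_blank ((congrArg (fun a : Γ.Sym × Option M.State => a.1) hi).symm.trans (h i))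
  · exact Γ.one_ne_blank ((congrArg (fun a : Γ.Sym × Option M.State => a.1) hi).symm.trans (h i))

theorem simulationRegisters_two_of_ne {p q : M.State} (h : q ≠ p) :
    simulationRegisters p 2 q = (none, some q) := by
  simp [simulationRegisters, exchange, h]

theorem simulationRegisters_two_self (p : M.State) :
    simulationRegisters p 2 p = (some p, none) := by
  simp [simulationRegisters, exchange]

/-- This is the dummy query. The second query tape carries only the parked state, so just the phase
changes, for any oracle. -/
theorem Config.query_embed_two (c : M.Config) (h : c.state ≠ M.post 0)
    (A : Set (List M.StateAlphabet.Sym)) : (c.embed 2).query 1 A = c.embed 3 := by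
  have hreg : simulationRegisters (M.post 0) 3 c.state = simulationRegisters (M.post 0) 2 c.state :=
    by simp [simulationRegisters]
  refine Config.ext_uniformQuery ?_ rfl (fun i => ?_) ?_ (fun i => ?_) ?_
  · rw [control_embed, hreg, simulationRegisters_two_of_ne h]
    rfl
  · exact (c.head_embed_castSucc 2 i).trans (head_embed_castSucc ..).symm
  · exact (c.head_embed_last 2).trans (head_embed_last ..).symm
  · refine (Function.update_of_ne (Fin.castSucc_lt_last i).ne _ _).trans ?_
    rw [tape_embed_castSucc, tape_embed_castSucc]
  · refine (Function.update_self (Fin.last (k + 1)) _ _).trans ?_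
    refine (congrArg (Tape.query A) (c.tape_embed_last 2)).trans ?_
    rw [tape_embed_last, query_stored_state, hreg]

theorem Config.query_embed_zero (c : M.Config) (A : Set (List Γ.Sym)) :
    (c.embed 0).query 0 (M.stateInclusion.oracle A) = (c.query 0 A).embed 1 := by
  refine Config.ext_uniformQuery rfl rfl (fun i => ?_) ?_ (fun i => ?_) ?_
  · exact (c.head_embed_castSucc 0 i).trans ((c.query 0 A).head_embed_castSucc 1 i).symm
  · exact (c.head_embed_last 0).trans ((c.query 0 A).head_embed_last 1).symm
  · rw [tape_embed_castSucc]
    by_cases hi : i = Fin.natAdd k 0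
    · subst hi
      refine (Function.update_self (Fin.castSucc (Fin.natAdd k 0)) _ _).trans ?_
      refine (congrArg (Tape.query _) (c.tape_embed_castSucc 0 (Fin.natAdd k 0))).trans ?_
      rw [← Tape.lift_query]
      exact congrArg (Tape.lift _) (Function.update_self (Fin.natAdd k 0) _ c.tape).symm
    · refine (Function.update_of_ne (a' := Fin.castSucc (Fin.natAdd k 0))
        (fun h => hi (Fin.castSucc_injective _ h)) _ _).trans ?_
      rw [tape_embed_castSucc]
      exact congrArg (Tape.lift _) (Function.update_of_ne hi _ c.tape).symm
  · refine (Function.update_of_ne (a' := Fin.castSucc (Fin.natAdd k 0))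
      (Fin.castSucc_lt_last _).ne' _ _).trans ?_
    rw [tape_embed_last, tape_embed_last]
    rfl

theorem Config.visible_embed_zero (c : M.Config) : (c.embed 0).visible c.state = c := by
  refine Config.ext' rfl (c.head_embed_castSucc 0) fun i => ?_
  simp only [visible, tape_embed_castSucc]
  rfl

theorem Config.replace_embed_zero (c d : M.Config) : (c.embed 0).replace d = d.embed 1 := by
  refine Config.ext_uniformQuery rfl rfl (fun i => ?_) ?_ (fun i => ?_) ?_
  · rw [head_replace_castSucc, head_embed_castSucc]
  · rw [head_replace_last, head_embed_last, head_embed_last]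
  · rw [tape_replace_castSucc, tape_embed_castSucc, tape_embed_castSucc]
    rfl
  · rw [tape_replace_last, tape_embed_last, tape_embed_last]
    rfl

/-- Locates the queries within a block. Phase 0 concerns the configuration before the step of `M`,
phase 2 the one after it. -/
theorem Config.isQuery_embed_iff (r : Fin 7) (c : M.Config) :
    (c.embed r).IsQuery ↔ (r = 0 ∧ c.IsQuery) ∨ (r = 2 ∧ c.state ≠ M.post 0) := by
  rw [uniformQuery_isQuery_iff, isQuery_iff, phase_embed, control_embed]
  by_cases h2 : r = 2
  · subst h2
    by_cases h : c.state = M.post 0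
    · simp [h, simulationRegisters_two_self]
    · simp [h, simulationRegisters_two_of_ne h]
  · by_cases h0 : r = 0
    · subst h0
      simp [simulationRegisters]
    · simp [h0, h2]

/-- After phase 0 the represented configuration is frozen until the next block, whether phase 2 is a
dummy query or a deterministic transition. -/
theorem step_embed_of_ne_zero (𝒜 : Fin 2 → Set (List M.StateAlphabet.Sym)) {r : Fin 7}
    (hr : r ≠ 0) (c : M.Config) :
    M.uniformQuery.step 𝒜 (c.embed r) = Finsupp.single (c.embed (r + 1)) 1 := by
  by_cases hq : (c.embed r).IsQuery
  · have hq' := (c.isQuery_embed_iff r).1 hq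
    obtain ⟨rfl, h⟩ := hq'.resolve_left fun h => hr h.1
    rw [uniformQuery_step_query_one 𝒜 _ rfl, Config.query_embed_two c h]
    · rfl
    · rw [Config.control_embed, simulationRegisters_two_of_ne h]
  · rw [uniformQuery_step_bookkeeping 𝒜 hq (Or.inr hr)]
    congr 1
    by_cases h2 : r = 2
    · subst h2
      -- Phase 2 without a query means that `M` has just made one, so no state is parked.
      have h : c.state = M.post 0 := by
        by_contra h
        exact hq ((c.isQuery_embed_iff 2).2 (Or.inr ⟨rfl, h⟩))
      apply Config.bookkeep_embed
      simp [nextRegisters, simulationRegisters, exchange, h]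
    · exact Config.bookkeep_embed (nextRegisters_simulationRegisters _ h2 _)

theorem step_embed_zero (A : Set (List Γ.Sym)) (c : M.Config) :
    M.uniformQuery.step (fun _ => M.stateInclusion.oracle A) (c.embed 0) =
      Finsupp.mapDomain (Config.embed 1) (M.step (fun _ => A) c) := by
  by_cases hq : c.state = M.pre 0
  · rw [uniformQuery_step_query_zero _ ((c.control_embed 0).trans (congrArg some hq)) rfl, M.step_of_state_eq_pre _ hq,
      Finsupp.mapDomain_single, Config.query_embed_zero]
  · rw [uniformQuery_step_simulated _ (fun _ => A) (c.control_embed 0) rfl hq,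
      Config.visible_embed_zero]
    congr 1
    exact funext c.replace_embed_zero

end OracleQTM

/-! ### Runs: halting time, acceptance probability and number of queries. -/

namespace OracleQTM

theorem superposition_succ {Γ : Alphabet.{u}} {k m : ℕ} (N : OracleQTM Γ k m)
    (𝒜 : Fin m → Set (List Γ.Sym)) (x : Fin k → List Γ.Sym) (t : ℕ) :
    N.superposition 𝒜 x (t + 1) = N.evolution 𝒜 (N.superposition 𝒜 x t) := by
  simp only [superposition, pow_succ']
  rfl

/-- The norm stays 1. This rules out that the halting condition holds vacuously. -/
theorem WellFormed.superposition_ne_zero {Γ : Alphabet.{u}} {k m : ℕ} {N : OracleQTM Γ k m}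
    (hN : N.WellFormed) (𝒜 : Fin m → Set (List Γ.Sym)) (x : Fin k → List Γ.Sym) (t : ℕ) :
    N.superposition 𝒜 x t ≠ 0 := by
  have h : ((N.superposition 𝒜 x t).sum fun _ a => ‖a‖ ^ 2) = 1 := by
    induction t with
    | zero => simp [superposition]
    | succ t ih => rw [superposition_succ, hN, ih]
  intro h0
  simp [h0] at h

open Classical in
theorem queryCount_succ {Γ : Alphabet.{u}} {k m : ℕ} {N : OracleQTM Γ k m} (n : ℕ)
    (c : ℕ → N.Config) :
    N.queryCount (n + 1) c = N.queryCount n c + if (c n).IsQuery then 1 else 0 := by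
  unfold queryCount
  rw [Finset.range_add_one, Finset.filter_insert]
  split_ifs
  · rw [Finset.card_insert_of_notMem (by simp)]
  · rfl

theorem initConfig_tape_castAdd {Γ : Alphabet.{u}} {k m : ℕ} (N : OracleQTM Γ k m)
    (x : Fin k → List Γ.Sym) (i : Fin k) :
    (N.initConfig x).tape (Fin.castAdd m i) = Tape.ofWord 0 (x i) := by
  simp [initConfig]

theorem initConfig_tape_natAdd {Γ : Alphabet.{u}} {k m : ℕ} (N : OracleQTM Γ k m)
    (x : Fin k → List Γ.Sym) (i : Fin m) :
    (N.initConfig x).tape (Fin.natAdd k i) = Tape.ofWord 0 [] := by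
  simp [initConfig]

variable {Γ : Alphabet.{u}} {k : ℕ} {M : OracleQTM Γ k 1}

theorem phase_succ {r : ℕ} (hr : r + 1 < 7) :
    (⟨r, Nat.lt_of_succ_lt hr⟩ : Fin 7) + 1 = ⟨r + 1, hr⟩ := by
  have h : r < 6 := by omega
  interval_cases r <;> rfl

theorem evolution_embed_zero (A : Set (List Γ.Sym)) (φ : M.Config →₀ ℂ) :
    M.uniformQuery.evolution (fun _ => M.stateInclusion.oracle A)
        (Finsupp.mapDomain (Config.embed 0) φ) =
      Finsupp.mapDomain (Config.embed 1) (M.evolution (fun _ => A) φ) := by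
  induction φ using Finsupp.induction_linear with
  | zero => simp
  | add f g hf hg => simp only [Finsupp.mapDomain_add, map_add, hf, hg]
  | single c a =>
    simp only [evolution, Finsupp.mapDomain_single, Finsupp.linearCombination_single,
      step_embed_zero, Finsupp.mapDomain_smul]

theorem evolution_embed_of_ne_zero (𝒜 : Fin 2 → Set (List M.StateAlphabet.Sym)) {r : Fin 7}
    (hr : r ≠ 0) (φ : M.Config →₀ ℂ) :
    M.uniformQuery.evolution 𝒜 (Finsupp.mapDomain (Config.embed r) φ) =
      Finsupp.mapDomain (Config.embed (r + 1)) φ := by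
  induction φ using Finsupp.induction_linear with
  | zero => simp
  | add f g hf hg => simp only [Finsupp.mapDomain_add, map_add, hf, hg]
  | single c a =>
    simp only [evolution, Finsupp.mapDomain_single, Finsupp.linearCombination_single,
      step_embed_of_ne_zero 𝒜 hr, Finsupp.smul_single, smul_eq_mul, mul_one]

theorem embed_initConfig (x : Fin k → List Γ.Sym) :
    (M.initConfig x).embed 0 = M.uniformQuery.initConfig fun i => M.stateInclusion.word (x i) := by
  refine Config.ext_uniformQuery rfl rfl (fun i => ?_) ?_ (fun i => ?_) ?_
  · rw [Config.head_embed_castSucc]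
    rfl
  · rw [Config.head_embed_last]
    rfl
  · rw [Config.tape_embed_castSucc]
    refine Fin.addCases (fun i => ?_) (fun i => ?_) i
    · rw [initConfig_tape_castAdd, Tape.lift_ofWord]
      exact (M.uniformQuery.initConfig_tape_castAdd
        (fun i => M.stateInclusion.word (x i)) i).symm
    · rw [initConfig_tape_natAdd, Tape.lift_ofWord]
      exact (M.uniformQuery.initConfig_tape_natAdd _ i.castSucc).symm
  · rw [Config.tape_embed_last]
    refine Eq.trans ?_ (M.uniformQuery.initConfig_tape_natAdd _ 1).symm
    refine Tape.ext fun j => ?_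
    by_cases hj : j = 0
    · subst hj
      refine (Tape.write_apply_self ..).trans ?_
      exact (Tape.ofWord_nil_apply (Γ := M.StateAlphabet) 0 0).symm
    · exact Tape.write_apply_of_ne _ _ hj

section run

variable (A : Set (List Γ.Sym)) (x : Fin k → List Γ.Sym)

/-- The first step of a block carries out the whole step of `M`, so from time `7 * s + 1` on the
superposition at time `s + 1` is represented. The start of the block is a hypothesis so that the
case `r = 6` can serve as induction step in `superposition_seven_mul`. -/
theorem superposition_seven_mul_add (s : ℕ)
    (h : M.uniformQuery.superposition (fun _ => M.stateInclusion.oracle A)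
        (fun i => M.stateInclusion.word (x i)) (7 * s) =
      Finsupp.mapDomain (Config.embed 0) (M.superposition (fun _ => A) x s)) (r : ℕ) (hr : r < 7) :
    M.uniformQuery.superposition (fun _ => M.stateInclusion.oracle A)
        (fun i => M.stateInclusion.word (x i)) (7 * s + r + 1) =
      Finsupp.mapDomain (Config.embed ((⟨r, hr⟩ : Fin 7) + 1))
        (M.superposition (fun _ => A) x (s + 1)) := by
  induction r with
  | zero =>
    rw [superposition_succ, superposition_succ, h, evolution_embed_zero]
    rfl
  | succ r ih =>
    rw [superposition_succ, ← add_assoc, ih (by omega), phase_succ hr,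
      evolution_embed_of_ne_zero _ (by simp [Fin.ext_iff])]

theorem superposition_seven_mul (s : ℕ) :
    M.uniformQuery.superposition (fun _ => M.stateInclusion.oracle A)
        (fun i => M.stateInclusion.word (x i)) (7 * s) =
      Finsupp.mapDomain (Config.embed 0) (M.superposition (fun _ => A) x s) := by
  induction s with
  | zero =>
    simp only [superposition, mul_zero, pow_zero, Module.End.one_apply, Finsupp.mapDomain_single,
      embed_initConfig]
  | succ s ih => exact superposition_seven_mul_add A x s ih 6 (by norm_num)

theorem phase_eq_of_superposition_ne_zero {s r : ℕ} (hr : r < 7) {c : M.uniformQuery.Config}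
    (h : M.uniformQuery.superposition (fun _ => M.stateInclusion.oracle A)
        (fun i => M.stateInclusion.word (x i)) (7 * s + r) c ≠ 0) : (c.phase : ℕ) = r := by
  classical
  have key : ∀ (φ : M.Config →₀ ℂ) (p : Fin 7),
      Finsupp.mapDomain (Config.embed p) φ c ≠ 0 → c.phase = p := by
    intro φ p hφ
    have hc := Finsupp.mapDomain_support (Finsupp.mem_support_iff.2 hφ)
    obtain ⟨d, -, rfl⟩ := Finset.mem_image.1 hc
    rfl
  rcases r with _ | r
  · rw [add_zero, superposition_seven_mul] at h
    rw [key _ _ h]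
    rfl
  · rw [← add_assoc, superposition_seven_mul_add A x s (superposition_seven_mul A x s) r
      (by omega)] at h
    rw [key _ _ h, phase_succ hr]

/-- Final states have phase 0, and the phase is the time modulo 7, so halting is possible only at
multiples of 7. There the encoding reflects finality. -/
theorem uniformQuery_haltsIn (hM : M.WellFormed) {T : ℕ} (hT : M.HaltsIn (fun _ => A) x T) :
    M.uniformQuery.HaltsIn (fun _ => M.stateInclusion.oracle A)
      (fun i => M.stateInclusion.word (x i)) (7 * T) := by
  classical
  constructor
  · intro c hc
    rw [superposition_seven_mul] at hc
    obtain ⟨d, hd, rfl⟩ :=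
      Finset.mem_image.1 (Finsupp.mapDomain_support (Finsupp.mem_support_iff.2 hc))
    exact ⟨d.state, hT.1 d (Finsupp.mem_support_iff.1 hd), rfl⟩
  · intro t ht
    obtain ⟨s, r, hr, rfl⟩ : ∃ s r, r < 7 ∧ t = 7 * s + r :=
      ⟨t / 7, t % 7, Nat.mod_lt _ (by norm_num), (Nat.div_add_mod t 7).symm⟩
    -- Some configuration has to occur at this time; its phase then forces `r = 0`.
    obtain ⟨c, hc⟩ := Finsupp.ne_iff.1 ((uniformQuery_wellFormed hM).superposition_ne_zero
      (fun _ => M.stateInclusion.oracle A) (fun i => M.stateInclusion.word (x i)) (7 * s + r))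
    have hphase := phase_eq_of_superposition_ne_zero A x hr hc
    obtain ⟨q, -, hq⟩ := ht c hc
    have h0 : c.phase = 0 := congrArg Prod.snd hq
    obtain rfl : r = 0 := by
      rw [h0] at hphase
      exact hphase.symm
    have hTs : T ≤ s := by
      refine hT.2 fun d hd => ?_
      have hd' : M.uniformQuery.superposition (fun _ => M.stateInclusion.oracle A)
          (fun i => M.stateInclusion.word (x i)) (7 * s + 0) (d.embed 0) ≠ 0 := by
        rwa [add_zero, superposition_seven_mul,
          Finsupp.mapDomain_apply Config.embed_zero_injective]
      obtain ⟨q, hq, h⟩ := ht _ hd'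
      obtain rfl : d.state = q := Option.some_injective _ (congrArg Prod.fst h)
      exact hq
    omega

/-- Since the encoding is injective, amplitudes are not merged, and the symbol `1` is seen on the
same tape in corresponding configurations. -/
theorem uniformQuery_acceptProb (T : ℕ) (j : Fin (k + 1)) :
    M.uniformQuery.acceptProb (fun _ => M.stateInclusion.oracle A)
        (fun i => M.stateInclusion.word (x i)) (7 * T) j.castSucc =
      M.acceptProb (fun _ => A) x T j := by
  classical
  unfold acceptProb
  rw [superposition_seven_mul, Finsupp.sum_mapDomain_index_inj Config.embed_zero_injective]
  refine Finset.sum_congr rfl fun c _ => ?_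
  refine if_congr ?_ rfl rfl
  rw [Config.tape_embed_castSucc, Tape.lift_apply, ← M.stateInclusion.map_one]
  exact M.stateInclusion.injective.eq_iff

/-- The course of a path during the seven steps which simulate a step of `M`. -/
theorem path_block (hM : M.WellFormed) {c : ℕ → M.uniformQuery.Config} {n : ℕ} {d : M.Config}
    (hd : c n = d.embed 0)
    (hc : ∀ t < n + 7, M.uniformQuery.step (fun _ => M.stateInclusion.oracle A) (c t)
      (c (t + 1)) ≠ 0) :
    (∃ d' : M.Config, c (n + 7) = d'.embed 0) ∧
      M.uniformQuery.queryCount (n + 7) c = M.uniformQuery.queryCount n c + 1 := by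
  classical
  have h0 := hc n (by omega)
  rw [hd, step_embed_zero] at h0
  obtain ⟨d', hd', h1⟩ :=
    Finset.mem_image.1 (Finsupp.mapDomain_support (Finsupp.mem_support_iff.2 h0))
  have hstep : ∀ (t : ℕ) (r : Fin 7), r ≠ 0 → t < n + 7 → c t = d'.embed r →
      c (t + 1) = d'.embed (r + 1) := by
    intro t r hr ht he
    by_contra hne
    apply hc t ht
    rw [he, step_embed_of_ne_zero _ hr, Finsupp.single_eq_of_ne hne]
  have h2 := hstep (n + 1) 1 (by decide) (by omega) h1.symm
  have h3 := hstep (n + 2) 2 (by decide) (by omega) h2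
  have h4 := hstep (n + 3) 3 (by decide) (by omega) h3
  have h5 := hstep (n + 4) 4 (by decide) (by omega) h4
  have h6 := hstep (n + 5) 5 (by decide) (by omega) h5
  have h7 := hstep (n + 6) 6 (by decide) (by omega) h6
  refine ⟨⟨d', h7⟩, ?_⟩
  -- The two possible queries of a block exclude each other and one of them occurs: `M` enters its
  -- post-query state exactly by making a query.
  have key : d.IsQuery ↔ ¬ d'.state ≠ M.post 0 := by
    rw [not_not]
    constructor
    · intro h
      by_contra hne
      rw [M.step_of_state_eq_pre _ (isQuery_iff.1 h), Finsupp.mem_support_iff] at hd'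
      refine hd' (Finsupp.single_eq_of_ne ?_)
      rintro rfl
      exact hne rfl
    · intro h
      by_contra hq
      exact Finsupp.mem_support_iff.1 hd' (hM.step_apply_eq_zero _ hq h)
  simp only [queryCount_succ, hd, ← h1, h2, h3, h4, h5, h6, Config.isQuery_embed_iff, key]
  by_cases h : d'.state = M.post 0
  · simp [h]
  · simp [h]

theorem uniformQuery_queryCount (hM : M.WellFormed) (T : ℕ) {c : ℕ → M.uniformQuery.Config}
    (hc : M.uniformQuery.IsPath (fun _ => M.stateInclusion.oracle A)
      (fun i => M.stateInclusion.word (x i)) (7 * T) c) :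
    M.uniformQuery.queryCount (7 * T) c = T := by
  have key : ∀ s ≤ T, (∃ d : M.Config, c (7 * s) = d.embed 0) ∧
      M.uniformQuery.queryCount (7 * s) c = s := by
    intro s
    induction s with
    | zero =>
      intro _
      refine ⟨⟨M.initConfig x, ?_⟩, ?_⟩
      · rw [embed_initConfig, mul_zero, hc.1]
      · simp [queryCount]
    | succ s ih =>
      intro hs
      obtain ⟨⟨d, hd⟩, hcount⟩ := ih (by omega)
      have := path_block A hM hd fun t ht => hc.2 t (by omega)
      rwa [hcount] at this
  exact (key T le_rfl).2

end run

end OracleQTM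

theorem mainTheorem11 (Γ : Alphabet.{u}) (k : ℕ) (M : OracleQTM Γ k 1)
    (hwf : M.WellFormed) (hnf : M.NormalForm) :
    ∃ (Γ' : Alphabet.{u}) (ι : Γ.Inclusion Γ') (M' : OracleQTM Γ' k 2),
      M'.WellFormed ∧
      ∀ (A : Set (List Γ.Sym)) (x : Fin k → List Γ.Sym) (T : ℕ),
        M.HaltsIn (fun _ => A) x T →
          M'.HaltsIn (fun _ => ι.oracle A) (fun i => ι.word (x i)) (7 * T) ∧
          (∀ c : ℕ → M'.Config,
            M'.IsPath (fun _ => ι.oracle A) (fun i => ι.word (x i)) (7 * T) c →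
              M'.queryCount (7 * T) c = T) ∧
          ∀ j : Fin (k + 1),
            M'.acceptProb (fun _ => ι.oracle A) (fun i => ι.word (x i)) (7 * T) j.castSucc =
              M.acceptProb (fun _ => A) x T j :=
  ⟨M.StateAlphabet, M.stateInclusion, M.uniformQuery, OracleQTM.uniformQuery_wellFormed hwf,
    fun A x T hT => ⟨OracleQTM.uniformQuery_haltsIn A x hwf hT,
      fun _ hc => OracleQTM.uniformQuery_queryCount A x hwf T hc,
      fun j => OracleQTM.uniformQuery_acceptProb A x T j⟩⟩
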